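/- Let $a,d\in\mathbb{R}$, $A_2=\begin{pmatrix} a&0\\1&d\end{pmatrix}$, and let $A_2D$ be the operator on $L^2(0,1)\otimes\mathbb{C}^2$ (norm $\|(\phi,\gamma)\|^2=\int_0^1(|\phi|^2+|\gamma|^2)$) given by $$A_2D\,f=-A_2f'',\qquad \mathrm{Dom}(A_2D)=\{f=(\phi,\gamma)\in W^{2,2}(0,1)^2:\ \phi(0)=\phi(1)=0,\ \gamma'(0)=\gamma'(1)=0\}.$$ The spectrum $\sigma(A_2D)$ is the complement of the set of $z\in\mathbb{C}$ for which $A_2D-z$ is a bijection from its domain onto the space with bounded inverse. For $\alpha\le\beta$ let $S(\alpha,\beta)=\{re^{i\theta}: r\ge 0,\ \alpha\le\theta\le\beta\}$. The following hold. (a) If $ad=0$, then $A_2D$ is not closed and $\sigma(A_2D)=\mathbb{C}$. (b) If $ad\neq0$, then $\sigma(A_2D)=\{a\pi^2n^2,\,d\pi^2n^2\}_{n=0}^\infty$; in particular the spectrum is real. (c) If $ad>0$, then for every $\varepsilon>0$ there is $k_\varepsilon>0$, independent of $z$, such that every $z\notin \pm S(-\varepsilon,\varepsilon)$ lies outside $\sigma(A_2D)$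 and satisfies $\|(A_2D-z)^{-1}\|\le k_\varepsilon/|z|$, where the sign $\pm$ is the sign of $a$. (d) If $ad<0$, then for every $\varepsilon>0$ there is $k_\varepsilon>0$, independent of $z$, such that every $z\notin S(-\varepsilon,\varepsilon)\cup S(-\pi-\varepsilon,-\pi+\varepsilon)$ lies outside $\sigma(A_2D)$ and satisfies $\|(A_2D-z)^{-1}\|\le k_\varepsilon/|z|$. (e) If $a=d\ne0$, then for every $\varepsilon>0$ there is $k_\varepsilon>0$, independent of $r$, such that for all $r=1,2,\dots$ and both choices of sign, the point $z_r=4a\pi^2r^2\pm i\varepsilon$ lies outside $\sigma(A_2D)$ and $\|(A_2D-z_r)^{-1}\|\ge k_\varepsilon|z_r|^{1/4}$. (f) If $a=d$, then $A_2D$ is not similar to a self-adjoint operator: there are no bounded operator $S$ with bounded inverse and self-adjoint operator $K$ on $L^2(0,1)\otimes\mathbb{C}^2$ with $SA_2DS^{-1}=K$ (including equality of domains). -/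

import Mathlib

open MeasureTheory Set
open scoped ContDiff Pointwise

noncomputable section

/-! ### Unbounded operators: resolvent, spectrum, similarity -/

/-- `R` is the resolvent `(T - z)⁻¹`: a bounded, everywhere defined operator with values in the
domain of `T` which is a two-sided inverse of `T - z : Dom T → E`. -/
def IsResolventAt {E : Type*} [NormedAddCommGroup E] [NormedSpace ℂ E]
    (T : E →ₗ.[ℂ] E) (z : ℂ) (R : E →L[ℂ] E) : Prop :=
  (∀ y : E, ∃ h : R y ∈ T.domain, T ⟨R y, h⟩ - z • R y = y) ∧
    ∀ x : T.domain, R (T x - z • (x : E)) = x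

/-- The spectrum of an unbounded operator: the complement of the set of all `z` for which
`(T - z)⁻¹` exists as a bounded operator. -/
def unboundedSpectrum {E : Type*} [NormedAddCommGroup E] [NormedSpace ℂ E]
    (T : E →ₗ.[ℂ] E) : Set ℂ :=
  {z | ¬ ∃ R : E →L[ℂ] E, IsResolventAt T z R}

/-- `T` is similar to a self-adjoint operator: `S T S⁻¹ = K` (equality of operators with their
domains, expressed by graphs) for some self-adjoint `K` and some bounded, boundedly invertible
`S`. -/
def IsSimilarToSelfAdjoint {E : Type*} [NormedAddCommGroup E] [InnerProductSpace ℂ E]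
    [CompleteSpace E] (T : E →ₗ.[ℂ] E) : Prop :=
  ∃ (S : E ≃L[ℂ] E) (K : E →ₗ.[ℂ] E), IsSelfAdjoint K ∧
    ∀ x y : E, (x, y) ∈ T.graph ↔ (S x, S y) ∈ K.graph

/-- The closed sector `S(α, β) = {z : α ≤ arg z ≤ β}`, where `arg` is multi-valued and the vertex
`0` belongs to the sector. -/
def sector (α β : ℝ) : Set ℂ :=
  {z | ∃ r θ : ℝ, 0 ≤ r ∧ α ≤ θ ∧ θ ≤ β ∧ z = r * Complex.exp (θ * Complex.I)}

/-! ### The Sobolev space of order two on `(0,1)` -/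

/-- `L²(0,1)`, complex valued. -/
abbrev L2I : Type := Lp ℂ 2 (volume.restrict (Ioo (0 : ℝ) 1))

/-- `L²(0,1) ⊗ ℂ²`, i.e. pairs `(φ, γ)` with `‖(φ, γ)‖² = ‖φ‖² + ‖γ‖²`. -/
abbrev L2I2 : Type := PiLp 2 (fun _ : Fin 2 => L2I)

/-- `g` is the generalized second derivative of `f` on `(0,1)`. -/
def HasWeakSecondDeriv (f g : L2I) : Prop :=
  ∀ ψ : ℝ → ℝ, ContDiff ℝ ∞ ψ → HasCompactSupport ψ → tsupport ψ ⊆ Ioo 0 1 →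
    ∫ x in Ioo (0 : ℝ) 1, deriv (deriv ψ) x • f x = ∫ x in Ioo (0 : ℝ) 1, ψ x • g x

theorem integrable_smul_L2I {ψ : ℝ → ℝ} (hc : Continuous ψ) (hs : HasCompactSupport ψ)
    (f : L2I) : Integrable (fun x => ψ x • f x) (volume.restrict (Ioo (0 : ℝ) 1)) := by
  have hf : Integrable f (volume.restrict (Ioo (0 : ℝ) 1)) :=
    (Lp.memLp f).integrable (by norm_num)
  obtain ⟨C, hC⟩ := hc.bounded_above_of_compact_support hs
  exact hf.bdd_smul C hc.aestronglyMeasurable (Filter.Eventually.of_forall hC)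

theorem HasWeakSecondDeriv.unique {f g g' : L2I} (h : HasWeakSecondDeriv f g)
    (h' : HasWeakSecondDeriv f g') : g = g' := by
  have hint (u : L2I) : IntegrableOn u (Ioo (0 : ℝ) 1) :=
    (Lp.memLp u).integrable (by norm_num)
  have key := isOpen_Ioo.ae_eq_zero_of_integral_contDiff_smul_eq_zero
    (μ := volume) (f := fun x => g x - g' x)
    (((hint g).sub (hint g')).locallyIntegrableOn) (by
      intro ψ hψ hs ht
      rw [← setIntegral_eq_integral_of_forall_compl_eq_zero (s := Ioo (0 : ℝ) 1)]
      · simp only [smul_sub]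
        rw [integral_sub (integrable_smul_L2I hψ.continuous hs g)
          (integrable_smul_L2I hψ.continuous hs g'), ← h ψ hψ hs ht, ← h' ψ hψ hs ht, sub_self]
      · intro x hx
        rw [image_eq_zero_of_notMem_tsupport (fun hx' => hx (ht hx')), zero_smul])
  apply Lp.ext
  rw [Filter.EventuallyEq, ae_restrict_iff' measurableSet_Ioo]
  filter_upwards [key] with x hx hx'
  exact sub_eq_zero.1 (hx hx')

theorem integrable_deriv_smul_L2I {ψ : ℝ → ℝ} (hc : ContDiff ℝ ∞ ψ) (hs : HasCompactSupport ψ)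
    (f : L2I) :
    Integrable (fun x => deriv (deriv ψ) x • f x) (volume.restrict (Ioo (0 : ℝ) 1)) := by
  have h1 : ContDiff ℝ ∞ (deriv ψ) := (contDiff_infty_iff_deriv.1 hc).2
  have h2 : ContDiff ℝ ∞ (deriv (deriv ψ)) := (contDiff_infty_iff_deriv.1 h1).2
  exact integrable_smul_L2I h2.continuous hs.deriv.deriv f

theorem HasWeakSecondDeriv.add {f₁ f₂ g₁ g₂ : L2I} (h₁ : HasWeakSecondDeriv f₁ g₁)
    (h₂ : HasWeakSecondDeriv f₂ g₂) : HasWeakSecondDeriv (f₁ + f₂) (g₁ + g₂) := by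
  intro ψ hψ hs ht
  have e₁ : ∫ x in Ioo (0 : ℝ) 1, deriv (deriv ψ) x • (f₁ + f₂ : L2I) x =
      ∫ x in Ioo (0 : ℝ) 1, (deriv (deriv ψ) x • f₁ x + deriv (deriv ψ) x • f₂ x) := by
    apply integral_congr_ae
    filter_upwards [Lp.coeFn_add f₁ f₂] with x hx
    rw [hx, Pi.add_apply, smul_add]
  have e₂ : ∫ x in Ioo (0 : ℝ) 1, ψ x • (g₁ + g₂ : L2I) x =
      ∫ x in Ioo (0 : ℝ) 1, (ψ x • g₁ x + ψ x • g₂ x) := by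
    apply integral_congr_ae
    filter_upwards [Lp.coeFn_add g₁ g₂] with x hx
    rw [hx, Pi.add_apply, smul_add]
  rw [e₁, e₂, integral_add (integrable_deriv_smul_L2I hψ hs f₁) (integrable_deriv_smul_L2I hψ hs f₂),
    integral_add (integrable_smul_L2I hψ.continuous hs g₁)
      (integrable_smul_L2I hψ.continuous hs g₂), h₁ ψ hψ hs ht, h₂ ψ hψ hs ht]

theorem HasWeakSecondDeriv.smul {f g : L2I} (c : ℂ) (h : HasWeakSecondDeriv f g) :
    HasWeakSecondDeriv (c • f) (c • g) := by
  intro ψ hψ hs ht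
  have e (u : ℝ → ℝ) (k : L2I) : ∫ x in Ioo (0 : ℝ) 1, u x • (c • k : L2I) x =
      c • ∫ x in Ioo (0 : ℝ) 1, u x • k x := by
    rw [← integral_smul]
    apply integral_congr_ae
    filter_upwards [Lp.coeFn_smul c k] with x hx
    rw [hx, Pi.smul_apply, smul_comm]
  rw [e, e, h ψ hψ hs ht]

theorem HasWeakSecondDeriv.zero : HasWeakSecondDeriv 0 0 := by
  simpa using HasWeakSecondDeriv.smul (f := 0) (g := 0) 0 (by
    intro ψ _ _ _
    have e (u : ℝ → ℝ) : ∫ x in Ioo (0 : ℝ) 1, u x • (0 : L2I) x = 0 := by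
      rw [← integral_zero ℝ ℂ (μ := volume.restrict (Ioo (0 : ℝ) 1))]
      apply integral_congr_ae
      filter_upwards [Lp.coeFn_zero ℂ 2 (volume.restrict (Ioo (0 : ℝ) 1))] with x hx
      rw [hx, Pi.zero_apply, smul_zero]
    rw [e, e])

/-- The Sobolev space `W^{2,2}(0,1)`: all `f ∈ L²(0,1)` whose generalized second derivative is
in `L²(0,1)`. -/
def sobolevTwo : Submodule ℂ L2I where
  carrier := {f | ∃ g : L2I, HasWeakSecondDeriv f g}
  add_mem' := fun ⟨g₁, h₁⟩ ⟨g₂, h₂⟩ => ⟨g₁ + g₂, h₁.add h₂⟩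
  zero_mem' := ⟨0, HasWeakSecondDeriv.zero⟩
  smul_mem' := fun c _ ⟨g, h⟩ => ⟨c • g, h.smul c⟩

/-- The generalized second derivative `f ↦ f''` on `W^{2,2}(0,1)`. -/
def secondDeriv : sobolevTwo →ₗ[ℂ] L2I where
  toFun f := Classical.choose f.2
  map_add' f₁ f₂ := (Classical.choose_spec (f₁ + f₂).2).unique
    ((Classical.choose_spec f₁.2).add (Classical.choose_spec f₂.2))
  map_smul' c f := (Classical.choose_spec (c • f).2).unique
    ((Classical.choose_spec f.2).smul c)

theorem secondDeriv_spec (f : sobolevTwo) : HasWeakSecondDeriv f (secondDeriv f) :=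
  Classical.choose_spec f.2

/-- `u` is a continuously differentiable representative of `f ∈ L²(0,1)`. It is the restriction of
`u` to `[0,1]` that matters: this restriction is determined by `f`, and every element of
`W^{2,2}(0,1)` has such a representative. Boundary values of `f` and of `f'` are those of `u` and
of `u'`. -/
def IsC1Rep (f : L2I) (u : ℝ → ℂ) : Prop :=
  ContDiff ℝ 1 u ∧ ∀ᵐ x ∂(volume.restrict (Ioo (0 : ℝ) 1)), f x = u x

theorem IsC1Rep.add {f₁ f₂ : L2I} {u₁ u₂ : ℝ → ℂ} (h₁ : IsC1Rep f₁ u₁) (h₂ : IsC1Rep f₂ u₂) :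
    IsC1Rep (f₁ + f₂) (u₁ + u₂) := by
  refine ⟨h₁.1.add h₂.1, ?_⟩
  filter_upwards [Lp.coeFn_add f₁ f₂, h₁.2, h₂.2] with x hx hx₁ hx₂
  rw [hx, Pi.add_apply, Pi.add_apply, hx₁, hx₂]

theorem IsC1Rep.smul {f : L2I} {u : ℝ → ℂ} (c : ℂ) (h : IsC1Rep f u) :
    IsC1Rep (c • f) (c • u) := by
  refine ⟨h.1.const_smul c, ?_⟩
  filter_upwards [Lp.coeFn_smul c f, h.2] with x hx hx₁
  rw [hx, Pi.smul_apply, Pi.smul_apply, hx₁]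

theorem IsC1Rep.zero : IsC1Rep 0 0 :=
  ⟨contDiff_const, Lp.coeFn_zero ℂ 2 (volume.restrict (Ioo (0 : ℝ) 1))⟩

/-- Dirichlet conditions: the functions of `W^{2,2}(0,1)` with `φ(0) = φ(1) = 0`. -/
def dirichletDomain : Submodule ℂ L2I where
  carrier := {f | f ∈ sobolevTwo ∧ ∃ u : ℝ → ℂ, IsC1Rep f u ∧ u 0 = 0 ∧ u 1 = 0}
  add_mem' := fun ⟨s₁, u₁, h₁, a₁, b₁⟩ ⟨s₂, u₂, h₂, a₂, b₂⟩ =>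
    ⟨add_mem s₁ s₂, u₁ + u₂, h₁.add h₂, by simp [a₁, a₂], by simp [b₁, b₂]⟩
  zero_mem' := ⟨zero_mem _, 0, IsC1Rep.zero, rfl, rfl⟩
  smul_mem' := fun c _ ⟨s, u, h, a, b⟩ =>
    ⟨Submodule.smul_mem _ c s, c • u, h.smul c, by simp [a], by simp [b]⟩

/-- Neumann conditions: the functions of `W^{2,2}(0,1)` with `γ'(0) = γ'(1) = 0`. -/
def neumannDomain : Submodule ℂ L2I where
  carrier := {f | f ∈ sobolevTwo ∧
    ∃ u : ℝ → ℂ, IsC1Rep f u ∧ deriv u 0 = 0 ∧ deriv u 1 = 0}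
  add_mem' := fun ⟨s₁, u₁, h₁, a₁, b₁⟩ ⟨s₂, u₂, h₂, a₂, b₂⟩ => by
    have d₁ := h₁.1.differentiable one_ne_zero
    have d₂ := h₂.1.differentiable one_ne_zero
    exact ⟨add_mem s₁ s₂, u₁ + u₂, h₁.add h₂,
      by rw [deriv_add (d₁ 0) (d₂ 0), a₁, a₂, add_zero],
      by rw [deriv_add (d₁ 1) (d₂ 1), b₁, b₂, add_zero]⟩
  zero_mem' := ⟨zero_mem _, 0, IsC1Rep.zero, by simp, by simp⟩
  smul_mem' := fun c _ ⟨s, u, h, a, b⟩ => by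
    have d := h.1.differentiable one_ne_zero
    exact ⟨Submodule.smul_mem _ c s, c • u, h.smul c,
      by rw [deriv_const_smul c (d 0), a, smul_zero],
      by rw [deriv_const_smul c (d 1), b, smul_zero]⟩

/-! ### The operators `AD` -/

/-- `Dom(D)`: pairs `(φ, γ)` in `W^{2,2}` with `φ(0) = φ(1) = 0` and `γ'(0) = γ'(1) = 0`. -/
def domD : Submodule ℂ L2I2 where
  carrier := {f | f 0 ∈ dirichletDomain ∧ f 1 ∈ neumannDomain}
  add_mem' := fun h₁ h₂ => ⟨add_mem h₁.1 h₂.1, add_mem h₁.2 h₂.2⟩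
  zero_mem' := ⟨zero_mem _, zero_mem _⟩
  smul_mem' := fun c _ h => ⟨Submodule.smul_mem _ c h.1, Submodule.smul_mem _ c h.2⟩

theorem domD_le_sobolevTwo (f : domD) (i : Fin 2) : (f : L2I2) i ∈ sobolevTwo := by
  fin_cases i
  · exact f.2.1.1
  · exact f.2.2.1

/-- The operator `AD f = -A f''` with domain `Dom(D)`. -/
def opAD (A : Matrix (Fin 2) (Fin 2) ℂ) : L2I2 →ₗ.[ℂ] L2I2 where
  domain := domD
  toFun :=
    { toFun := fun f => WithLp.toLp 2 fun i =>
        -∑ j, A i j • secondDeriv ⟨(f : L2I2) j, domD_le_sobolevTwo f j⟩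
      map_add' := fun f g => by
        have h (j : Fin 2) :
            secondDeriv ⟨((f + g : domD) : L2I2) j, domD_le_sobolevTwo (f + g) j⟩ =
            secondDeriv ⟨(f : L2I2) j, domD_le_sobolevTwo f j⟩ +
              secondDeriv ⟨(g : L2I2) j, domD_le_sobolevTwo g j⟩ := by
          rw [← map_add]; rfl
        simp only [h, smul_add, Finset.sum_add_distrib, neg_add]
        rfl
      map_smul' := fun c f => by
        have h (j : Fin 2) :
            secondDeriv ⟨((c • f : domD) : L2I2) j, domD_le_sobolevTwo (c • f) j⟩ =
            c • secondDeriv ⟨(f : L2I2) j, domD_le_sobolevTwo f j⟩ := by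
          rw [← map_smul]; rfl
        simp only [h, smul_comm _ c, ← Finset.smul_sum, ← smul_neg]
        rfl }

/-- The matrix `A₂ = [[a, 0], [1, d]]`. -/
def matA2 (a d : ℝ) : Matrix (Fin 2) (Fin 2) ℂ := !![(a : ℂ), 0; 1, (d : ℂ)]

/-- The operator `A₂D`. -/
def opA2D (a d : ℝ) : L2I2 →ₗ.[ℂ] L2I2 := opAD (matA2 a d)

end

/-! ### Absolutely continuous functions on `[0,1]` -/

/-! Write `L_D`, `L_N` for `-d²/dx²` with Dirichlet and Neumann conditions. The operator is lower
triangular, `(φ, γ) ↦ (a L_D φ, L_D φ + d L_N γ)`, so everything reduces to these two symmetric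
nonnegative operators. If `ad ≠ 0`, solving `(A₂D - z)(φ, γ) = (f, g)` gives `φ = (a L_D - z)⁻¹ f`
and `γ = (d L_N - z)⁻¹ (g - L_D φ)`. The coupling term `L_D φ = a⁻¹ (f + z φ)` contains no unbounded
operator, so the scalar resolvents suffice (`exists_isResolventAt_opA2D`). They exist off `π²n²`:
the boundary value problems are solved explicitly, and for a symmetric operator surjectivity at `z`
and `z̄` already yields a bounded inverse. Conversely, `d π²n²` are eigenvalues, and at `a π²n²`
with `n ≥ 1` surjectivity fails in the first component.

Nonnegativity bounds each scalar resolvent by the inverse distance of `z` to a ray. Outside the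
sectors this distance is at least `c |z|`, which gives the `k / |z|` bounds.

If `ad = 0`, the kernel contains `(-d f, f)` for a dense set of `f`; closedness would put all of
`L²` into `W^{2,2}`, as would a resolvent at any point.

For `a = d` near `4aπ²r²`, feed in `(sin 2πrx, 0)`. Then `φ` is the sine divided by a number of
modulus `ε`, so `L_D φ` has size `r²`. Sines and cosines of opposite parity are not orthogonal:
testing `γ` against `cos (2r-1)πx` costs only an eigenvalue gap of order `r`, so the resolvent grows
like `r` (`resolvent_norm_ge`). A closed operator similar to a self-adjoint one has bounded
resolvent on `|Im z| = 1`, which excludes similarity; for `a = 0` closedness itself fails. -/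

theorem AbsolutelyContinuousOnInterval.congr {X : Type*} [PseudoMetricSpace X] {f g : ℝ → X}
    {a b : ℝ} (hf : AbsolutelyContinuousOnInterval f a b) (h : EqOn g f (uIcc a b)) :
    AbsolutelyContinuousOnInterval g a b := by
  rw [absolutelyContinuousOnInterval_iff] at hf ⊢
  intro ε hε
  obtain ⟨δ, hδ, H⟩ := hf ε hε
  refine ⟨δ, hδ, fun E hE hlt => ?_⟩
  convert! H E hE hlt using 1
  refine Finset.sum_congr rfl fun i hi => ?_
  rw [h (hE.1 i hi).1, h (hE.1 i hi).2]

theorem absolutelyContinuousOnInterval_integral {g : ℝ → ℂ}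
    (hg : IntervalIntegrable g volume 0 1) :
    AbsolutelyContinuousOnInterval (fun x => ∫ t in (0 : ℝ)..x, g t) 0 1 := by
  have hre : IntervalIntegrable (fun t => (g t).re) volume 0 1 := ⟨hg.1.re, hg.2.re⟩
  have him : IntervalIntegrable (fun t => (g t).im) volume 0 1 := ⟨hg.1.im, hg.2.im⟩
  have h1 := (hre.absolutelyContinuousOnInterval_intervalIntegral (c := 0) (by simp)).smul
    (contDiff_const (c := (1 : ℂ))).contDiffOn.absolutelyContinuousOnInterval
  have h2 := (him.absolutelyContinuousOnInterval_intervalIntegral (c := 0) (by simp)).smul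
    (contDiff_const (c := Complex.I)).contDiffOn.absolutelyContinuousOnInterval
  refine (h1.add h2).congr fun x hx => ?_
  have hx' : IntervalIntegrable g volume 0 x := hg.mono_set (uIcc_subset_uIcc (by simp) hx)
  have e1 := intervalIntegral.intervalIntegral_re (𝕜 := ℂ) hx'
  have e2 := intervalIntegral.intervalIntegral_im (𝕜 := ℂ) hx'
  simp only [RCLike.re_to_complex, RCLike.im_to_complex] at e1 e2
  simp only [Pi.add_apply, Pi.smul_apply', e1, e2, Complex.real_smul, mul_one]
  exact (Complex.re_add_im _).symm

/-- `G` is, on `[0,1]`, an indefinite integral of the integrable function `g`. -/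
def IsPrimitive (G g : ℝ → ℂ) : Prop :=
  IntervalIntegrable g volume 0 1 ∧ ∀ x ∈ Icc (0 : ℝ) 1, G x = G 0 + ∫ t in (0 : ℝ)..x, g t

namespace IsPrimitive

variable {F G f g : ℝ → ℂ}

theorem absolutelyContinuous (h : IsPrimitive G g) : AbsolutelyContinuousOnInterval G 0 1 := by
  refine (((contDiff_const (c := G 0)).contDiffOn.absolutelyContinuousOnInterval).add
    (absolutelyContinuousOnInterval_integral h.1)).congr fun x hx => ?_
  rw [uIcc_of_le zero_le_one] at hx
  exact h.2 x hx

theorem continuousOn (h : IsPrimitive G g) : ContinuousOn G (uIcc 0 1) :=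
  h.absolutelyContinuous.continuousOn

theorem ae_hasDerivAt (h : IsPrimitive G g) : ∀ᵐ x, x ∈ uIcc (0 : ℝ) 1 → HasDerivAt G (g x) x := by
  -- `G` is controlled only on `[0,1]`, so a two-sided derivative is available only inside; the
  -- endpoints are discarded as a null set.
  have e (c : ℝ) : ∀ᵐ x : ℝ, x ≠ c := by simp [ae_iff]
  filter_upwards [h.1.ae_hasDerivAt_integral, e 0, e 1] with x hx h0 h1 hmem
  have hd := (hx hmem 0 (by simp)).const_add (G 0)
  rw [uIcc_of_le zero_le_one] at hmem
  refine hd.congr_of_eventuallyEq ?_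
  filter_upwards [Icc_mem_nhds (hmem.1.lt_of_ne' h0) (hmem.2.lt_of_ne h1)] with y hy
  exact h.2 y hy

/-- An absolutely continuous function with derivative zero almost everywhere is constant; applied to
`G` minus the integral of `g`. -/
theorem of_absolutelyContinuous (hG : AbsolutelyContinuousOnInterval G 0 1)
    (hg : IntervalIntegrable g volume 0 1)
    (hd : ∀ᵐ x, x ∈ uIcc (0 : ℝ) 1 → HasDerivAt G (g x) x) : IsPrimitive G g := by
  refine ⟨hg, ?_⟩
  obtain ⟨C, hC⟩ := (hG.sub (absolutelyContinuousOnInterval_integral hg)).const_of_ae_hasDerivAt_zero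
    (by
      filter_upwards [hd, hg.ae_hasDerivAt_integral] with x h1 h2 hx
      simpa using (h1 hx).sub (h2 hx 0 (by simp)))
  intro x hx
  have h0 := hC 0 (by simp)
  have h1 := hC x (by rwa [uIcc_of_le zero_le_one])
  simp only [Pi.sub_apply, intervalIntegral.integral_same, sub_zero] at h0 h1
  rw [h0, ← h1]; ring

theorem of_hasDerivAt (hd : ∀ x, HasDerivAt G (g x) x) (hg : Continuous g) : IsPrimitive G g := by
  refine ⟨hg.intervalIntegrable _ _, fun x _ => ?_⟩
  rw [intervalIntegral.integral_eq_sub_of_hasDerivAt (fun x _ => hd x) (hg.intervalIntegrable _ _)]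
  ring

theorem of_contDiff (hG : ContDiff ℝ 1 G) : IsPrimitive G (deriv G) :=
  of_hasDerivAt (fun x => (hG.differentiable one_ne_zero x).hasDerivAt)
    (hG.continuous_deriv le_rfl)

theorem integral_eq (h : IsPrimitive G g) : ∫ t in (0 : ℝ)..1, g t = G 1 - G 0 := by
  rw [h.2 1 (by simp)]; ring

theorem congr (h : IsPrimitive G g) (hF : ∀ x ∈ Icc (0 : ℝ) 1, F x = G x)
    (hf : ∀ᵐ x ∂volume.restrict (Ioo (0 : ℝ) 1), f x = g x) : IsPrimitive F f := by
  have hae : f =ᵐ[volume.restrict (uIoc (0 : ℝ) 1)] g := by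
    rwa [uIoc_of_le zero_le_one, restrict_Ioo_eq_restrict_Ioc.symm]
  refine ⟨h.1.congr_ae hae.symm, fun x hx => ?_⟩
  rw [hF x hx, hF 0 (by simp), h.2 x hx]
  congr 1
  refine intervalIntegral.integral_congr_ae_restrict (ae_restrict_of_ae_restrict_of_subset ?_ hae.symm)
  rw [uIoc_of_le hx.1, uIoc_of_le zero_le_one]
  exact Ioc_subset_Ioc_right hx.2

theorem add (hF : IsPrimitive F f) (hG : IsPrimitive G g) :
    IsPrimitive (fun x => F x + G x) (fun x => f x + g x) := by
  refine of_absolutelyContinuous (hF.absolutelyContinuous.add hG.absolutelyContinuous)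
    (hF.1.add hG.1) ?_
  filter_upwards [hF.ae_hasDerivAt, hG.ae_hasDerivAt] with x h1 h2 hx
  exact (h1 hx).add (h2 hx)

/-- Together with `integral_eq` this is integration by parts when the derivatives are merely
integrable. -/
theorem mul (hF : IsPrimitive F f) (hG : IsPrimitive G g) :
    IsPrimitive (fun x => F x * G x) (fun x => f x * G x + F x * g x) := by
  refine of_absolutelyContinuous (hF.absolutelyContinuous.smul hG.absolutelyContinuous)
    ((hF.1.mul_continuousOn hG.continuousOn).add (hG.1.continuousOn_mul hF.continuousOn)) ?_
  filter_upwards [hF.ae_hasDerivAt, hG.ae_hasDerivAt] with x h1 h2 hx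
  exact (h1 hx).mul (h2 hx)

theorem const_mul (c : ℂ) (hF : IsPrimitive F f) :
    IsPrimitive (fun x => c * F x) (fun x => c * f x) := by
  refine ⟨hF.1.const_mul c, fun x hx => ?_⟩
  simp only [intervalIntegral.integral_const_mul, hF.2 x hx]; ring

theorem conj (hF : IsPrimitive F f) :
    IsPrimitive (fun x => (starRingEnd ℂ) (F x)) (fun x => (starRingEnd ℂ) (f x)) := by
  have hi : IntervalIntegrable (fun x => (starRingEnd ℂ) (f x)) volume 0 1 :=
    ⟨Complex.conjCLE.toContinuousLinearMap.integrable_comp hF.1.1,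
      Complex.conjCLE.toContinuousLinearMap.integrable_comp hF.1.2⟩
  refine ⟨hi, fun x hx => ?_⟩
  have hsub : uIcc 0 x ⊆ uIcc (0 : ℝ) 1 :=
    uIcc_subset_uIcc (by simp) (by rwa [uIcc_of_le zero_le_one])
  have h := Complex.conjCLE.toContinuousLinearMap.intervalIntegral_comp_comm (hF.1.mono_set hsub)
  simp only [ContinuousLinearEquiv.coe_coe, Complex.conjCLE_apply] at h
  simp only [hF.2 x hx, map_add, h]

theorem ofReal {ψ : ℝ → ℝ} (hψ : ContDiff ℝ 1 ψ) :
    IsPrimitive (fun x => (ψ x : ℂ)) (fun x => ((deriv ψ x : ℝ) : ℂ)) :=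
  of_hasDerivAt (fun x => ((hψ.differentiable one_ne_zero x).hasDerivAt).ofReal_comp)
    (Complex.continuous_ofReal.comp (hψ.continuous_deriv le_rfl))

end IsPrimitive

/-! ### Weak second derivatives and absolutely continuous first derivatives -/

theorem setIntegral_Ioo_eq_intervalIntegral (f : ℝ → ℂ) :
    ∫ x in Ioo (0 : ℝ) 1, f x = ∫ x in (0 : ℝ)..1, f x := by
  rw [intervalIntegral.integral_of_le zero_le_one, integral_Ioc_eq_integral_Ioo]

theorem exists_pos_subset_Icc_of_isCompact {K : Set ℝ} (hK : IsCompact K) (h : K ⊆ Ioo 0 1) :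
    ∃ δ > 0, K ⊆ Icc δ (1 - δ) := by
  obtain ⟨δ, hδ, H⟩ := hK.exists_cthickening_subset_open isOpen_Ioo h
  refine ⟨δ, hδ, fun x hx => ?_⟩
  have h1 := H (Metric.mem_cthickening_of_dist_le (x - δ) x δ K hx (by simp [abs_of_pos hδ]))
  have h2 := H (Metric.mem_cthickening_of_dist_le (x + δ) x δ K hx (by simp [abs_of_pos hδ]))
  exact ⟨by linarith [h1.1], by linarith [h2.2]⟩

/-- A test function on `(0,1)` with vanishing integral is the derivative of a test function. -/
theorem exists_testFunction_deriv_eq {θ : ℝ → ℝ} (hθ : ContDiff ℝ ∞ θ) (hs : HasCompactSupport θ)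
    (ht : tsupport θ ⊆ Ioo 0 1) (h0 : ∫ x in (0 : ℝ)..1, θ x = 0) :
    ∃ ψ : ℝ → ℝ, ContDiff ℝ ∞ ψ ∧ HasCompactSupport ψ ∧ tsupport ψ ⊆ Ioo 0 1 ∧ deriv ψ = θ := by
  obtain ⟨δ, hδ, hK⟩ := exists_pos_subset_Icc_of_isCompact hs ht
  have hz {x : ℝ} (hx : x ∉ Icc δ (1 - δ)) : θ x = 0 :=
    image_eq_zero_of_notMem_tsupport fun h => hx (hK h)
  have hd (x : ℝ) : HasDerivAt (fun x => ∫ t in (0 : ℝ)..x, θ t) (θ x) x :=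
    intervalIntegral.integral_hasDerivAt_right (hθ.continuous.intervalIntegrable _ _)
      (hθ.continuous.stronglyMeasurableAtFilter _ _) hθ.continuous.continuousAt
  have hde : deriv (fun x => ∫ t in (0 : ℝ)..x, θ t) = θ := funext fun x => (hd x).deriv
  have hsupp : Function.support (fun x => ∫ t in (0 : ℝ)..x, θ t) ⊆ Icc δ (1 - δ) := by
    intro x hx
    by_contra hx'
    apply hx
    rcases lt_or_ge x δ with h | h
    · refine intervalIntegral.integral_zero_ae (Filter.Eventually.of_forall fun t ht => hz ?_)
      intro h'
      have := (uIoc_subset_uIcc ht).2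
      exact (this.trans_lt (max_lt hδ h)).not_ge h'.1
    · have hx1 : 1 - δ < x := lt_of_not_ge fun h' => hx' ⟨h, h'⟩
      have h1 : ∫ t in x..1, θ t = 0 := by
        refine intervalIntegral.integral_zero_ae (Filter.Eventually.of_forall fun t ht => hz ?_)
        intro h'
        have := (uIoc_subset_uIcc ht).1
        exact ((lt_min hx1 (by linarith)).trans_le this).not_ge h'.2
      have := intervalIntegral.integral_add_adjacent_intervals
        (hθ.continuous.intervalIntegrable (μ := volume) 0 x)
        (hθ.continuous.intervalIntegrable (μ := volume) x 1)
      simp only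
      linarith
  have hsub : tsupport (fun x => ∫ t in (0 : ℝ)..x, θ t) ⊆ Icc δ (1 - δ) :=
    closure_minimal hsupp isClosed_Icc
  refine ⟨_, contDiff_infty_iff_deriv.2 ⟨fun x => (hd x).differentiableAt, by rwa [hde]⟩,
    HasCompactSupport.of_support_subset_isCompact isCompact_Icc hsupp,
    hsub.trans fun x hx => ⟨by linarith [hx.1], by linarith [hx.2]⟩, hde⟩

/-- The du Bois-Reymond lemma. -/
theorem exists_const_of_integral_deriv_smul_eq_zero {w : ℝ → ℂ}
    (hw : ContinuousOn w (Icc 0 1))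
    (h : ∀ ψ : ℝ → ℝ, ContDiff ℝ ∞ ψ → HasCompactSupport ψ → tsupport ψ ⊆ Ioo 0 1 →
      ∫ x in (0 : ℝ)..1, deriv ψ x • w x = 0) :
    ∃ c, ∀ x ∈ Icc (0 : ℝ) 1, w x = c := by
  have hI {η : ℝ → ℝ} (hη : Continuous η) {v : ℝ → ℂ} (hv : ContinuousOn v (Icc 0 1)) :
      IntervalIntegrable (fun x => η x • v x) volume 0 1 :=
    (hη.continuousOn.smul (by rwa [uIcc_of_le zero_le_one])).intervalIntegrable
  -- A bump of mass one: subtracting a multiple of it gives any test function mean zero, hence makes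
  -- it a derivative. The constant sought is the `χ`-average of `w`.
  obtain ⟨χ, hχ, hχs, hχt, hχ1⟩ : ∃ χ : ℝ → ℝ, ContDiff ℝ ∞ χ ∧ HasCompactSupport χ ∧
      tsupport χ ⊆ Ioo 0 1 ∧ ∫ x in (0 : ℝ)..1, χ x = 1 := by
    let b : ContDiffBump (1 / 2 : ℝ) := ⟨1 / 8, 1 / 4, by norm_num, by norm_num⟩
    have ht : tsupport (b.normed volume) ⊆ Ioo 0 1 := by
      rw [b.tsupport_normed_eq, Real.closedBall_eq_Icc]
      intro x hx
      have e : b.rOut = 1 / 4 := rfl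
      rw [e] at hx
      exact ⟨by linarith [hx.1], by linarith [hx.2]⟩
    refine ⟨b.normed volume, b.contDiff_normed, b.hasCompactSupport_normed, ht, ?_⟩
    rw [intervalIntegral.integral_of_le zero_le_one]
    refine Eq.trans ?_ (b.integral_normed (μ := volume))
    refine setIntegral_eq_integral_of_forall_compl_eq_zero fun x hx => ?_
    exact image_eq_zero_of_notMem_tsupport fun h => hx (Ioo_subset_Ioc_self (ht h))
  set c : ℂ := ∫ x in (0 : ℝ)..1, χ x • w x with hc
  have key := isOpen_Ioo.ae_eq_zero_of_integral_contDiff_smul_eq_zero (U := Ioo (0 : ℝ) 1)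
    (μ := volume) (f := fun x => w x - c)
    ((((hw.sub continuousOn_const).integrableOn_Icc).mono_set
      Ioo_subset_Icc_self).locallyIntegrableOn) (by
      intro η hη hs ht
      rw [← setIntegral_eq_integral_of_forall_compl_eq_zero (s := Ioo (0 : ℝ) 1) (fun x hx => by
        rw [image_eq_zero_of_notMem_tsupport (fun hx' => hx (ht hx')), zero_smul]),
        setIntegral_Ioo_eq_intervalIntegral]
      set m : ℝ := ∫ x in (0 : ℝ)..1, η x with hm
      obtain ⟨ψ, h1, h2, h3, h4⟩ := exists_testFunction_deriv_eq (θ := fun x => η x - m * χ x)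
        (hη.sub (contDiff_const.mul hχ)) (hs.sub (hχs.mul_left (f := fun _ => m)))
        ((tsupport_sub _ _).trans (union_subset ht
          ((tsupport_mul_subset_right (f := fun _ => m)).trans hχt)))
        (by
          rw [intervalIntegral.integral_sub (hη.continuous.intervalIntegrable _ _)
            ((hχ.continuous.const_mul m).intervalIntegrable _ _),
            intervalIntegral.integral_const_mul, hχ1, mul_one, sub_self])
      have h5 := h ψ h1 h2 h3
      simp only [h4, sub_smul, mul_smul] at h5
      have h6 : IntervalIntegrable (fun x => m • χ x • w x) volume 0 1 :=
        (hI hχ.continuous hw).smul m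
      rw [intervalIntegral.integral_sub (hI hη.continuous hw) h6,
        intervalIntegral.integral_smul, ← hc] at h5
      simp only [smul_sub]
      rw [intervalIntegral.integral_sub (hI hη.continuous hw)
        (hI hη.continuous continuousOn_const), intervalIntegral.integral_smul_const, ← hm, h5])
  refine ⟨c, Measure.eqOn_Icc_of_ae_eq volume zero_ne_one ?_ hw continuousOn_const⟩
  rw [← restrict_Ioo_eq_restrict_Icc, Filter.EventuallyEq, ae_restrict_iff' measurableSet_Ioo]
  filter_upwards [key] with x hx hx'
  exact sub_eq_zero.1 (hx hx')

theorem testFunction_endpoints {ψ : ℝ → ℝ} (ht : tsupport ψ ⊆ Ioo 0 1) :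
    (ψ 0 = 0 ∧ ψ 1 = 0) ∧ deriv ψ 0 = 0 ∧ deriv ψ 1 = 0 := by
  have h0 : (0 : ℝ) ∉ tsupport ψ := fun h => (ht h).1.false
  have h1 : (1 : ℝ) ∉ tsupport ψ := fun h => (ht h).2.false
  exact ⟨⟨image_eq_zero_of_notMem_tsupport h0, image_eq_zero_of_notMem_tsupport h1⟩,
    Function.notMem_support.1 fun h => h0 (support_deriv_subset h),
    Function.notMem_support.1 fun h => h1 (support_deriv_subset h)⟩

theorem intervalIntegrable_L2I (f : L2I) : IntervalIntegrable f volume 0 1 := by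
  rw [intervalIntegrable_iff_integrableOn_Ioo_of_le zero_le_one]
  exact (Lp.memLp f).integrable (by norm_num)

theorem IsC1Rep.integral_smul_eq {f : L2I} {u : ℝ → ℂ} (hu : IsC1Rep f u) (η : ℝ → ℝ) :
    ∫ x in Ioo (0 : ℝ) 1, η x • f x = ∫ x in (0 : ℝ)..1, (η x : ℂ) * u x := by
  rw [← setIntegral_Ioo_eq_intervalIntegral]
  refine integral_congr_ae ?_
  filter_upwards [hu.2] with x hx
  rw [hx, Complex.real_smul]

theorem integral_deriv_deriv_mul {ψ : ℝ → ℝ} {u : ℝ → ℂ} (hψ : ContDiff ℝ ∞ ψ)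
    (ht : tsupport ψ ⊆ Ioo 0 1) (hu : ContDiff ℝ 1 u) :
    ∫ x in (0 : ℝ)..1, ((deriv (deriv ψ) x : ℝ) : ℂ) * u x =
      -∫ x in (0 : ℝ)..1, ((deriv ψ x : ℝ) : ℂ) * deriv u x := by
  have hψ' : ContDiff ℝ ∞ (deriv ψ) := (contDiff_infty_iff_deriv.1 hψ).2
  have hψ'' : ContDiff ℝ ∞ (deriv (deriv ψ)) := (contDiff_infty_iff_deriv.1 hψ').2
  have h := ((IsPrimitive.ofReal (hψ'.of_le (by simp))).mul (.of_contDiff hu)).integral_eq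
  rw [intervalIntegral.integral_add, (testFunction_endpoints ht).2.1,
    (testFunction_endpoints ht).2.2] at h
  · simpa using eq_neg_of_add_eq_zero_left (h.trans (by simp))
  · exact ((Complex.continuous_ofReal.comp hψ''.continuous).mul
      hu.continuous).intervalIntegrable _ _
  · exact ((Complex.continuous_ofReal.comp hψ'.continuous).mul
      (hu.continuous_deriv le_rfl)).intervalIntegrable _ _

theorem integral_deriv_mul_primitive {ψ : ℝ → ℝ} {G g : ℝ → ℂ} (hψ : ContDiff ℝ ∞ ψ)
    (ht : tsupport ψ ⊆ Ioo 0 1) (hG : IsPrimitive G g) :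
    ∫ x in (0 : ℝ)..1, ((deriv ψ x : ℝ) : ℂ) * G x = -∫ x in (0 : ℝ)..1, (ψ x : ℂ) * g x := by
  have hψ' : ContDiff ℝ ∞ (deriv ψ) := (contDiff_infty_iff_deriv.1 hψ).2
  have h := ((IsPrimitive.ofReal (hψ.of_le (by simp))).mul hG).integral_eq
  rw [intervalIntegral.integral_add, (testFunction_endpoints ht).1.1,
    (testFunction_endpoints ht).1.2] at h
  · simpa using eq_neg_of_add_eq_zero_left (h.trans (by simp))
  · exact ((Complex.continuous_ofReal.comp hψ'.continuous).continuousOn.mul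
      hG.continuousOn).intervalIntegrable
  · exact hG.1.continuousOn_mul (Complex.continuous_ofReal.comp hψ.continuous).continuousOn

theorem IsC1Rep.hasWeakSecondDeriv {f g : L2I} {u : ℝ → ℂ} (hu : IsC1Rep f u)
    (h : IsPrimitive (deriv u) g) : HasWeakSecondDeriv f g := by
  intro ψ hψ _ ht
  rw [hu.integral_smul_eq, integral_deriv_deriv_mul hψ ht hu.1,
    integral_deriv_mul_primitive hψ ht h, neg_neg, setIntegral_Ioo_eq_intervalIntegral]
  simp only [Complex.real_smul]

/-- One integration by parts on each side shows that `u' - ∫ g` annihilates derivatives of test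
functions; du Bois-Reymond makes it constant. -/
theorem HasWeakSecondDeriv.isPrimitive_deriv {f g : L2I} {u : ℝ → ℂ} (h : HasWeakSecondDeriv f g)
    (hu : IsC1Rep f u) : IsPrimitive (deriv u) g := by
  have hg := intervalIntegrable_L2I g
  have hG : IsPrimitive (fun x => ∫ t in (0 : ℝ)..x, g t) g := ⟨hg, fun x _ => by simp⟩
  have hu' : Continuous (deriv u) := hu.1.continuous_deriv le_rfl
  obtain ⟨c, hc⟩ := exists_const_of_integral_deriv_smul_eq_zero
    (w := fun x => deriv u x - ∫ t in (0 : ℝ)..x, g t)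
    (hu'.continuousOn.sub (by simpa [uIcc_of_le] using hG.continuousOn)) (by
      intro ψ hψ hs ht
      have hψ' : ContDiff ℝ ∞ (deriv ψ) := (contDiff_infty_iff_deriv.1 hψ).2
      have hcψ : Continuous fun x => ((deriv ψ x : ℝ) : ℂ) :=
        Complex.continuous_ofReal.comp hψ'.continuous
      have hi : IntervalIntegrable
          (fun x => ((deriv ψ x : ℝ) : ℂ) * ∫ t in (0 : ℝ)..x, g t) volume 0 1 :=
        (hcψ.continuousOn.mul hG.continuousOn).intervalIntegrable
      have hi' : IntervalIntegrable
          (fun x => ((deriv ψ x : ℝ) : ℂ) * deriv u x) volume 0 1 :=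
        (hcψ.mul hu').intervalIntegrable _ _
      simp only [Complex.real_smul, mul_sub]
      rw [intervalIntegral.integral_sub hi' hi,
        integral_deriv_mul_primitive hψ ht hG, sub_neg_eq_add]
      have h1 := h ψ hψ hs ht
      rw [hu.integral_smul_eq, integral_deriv_deriv_mul hψ ht hu.1,
        setIntegral_Ioo_eq_intervalIntegral] at h1
      simp only [Complex.real_smul] at h1
      rw [← h1, add_neg_cancel])
  refine ⟨hg, fun x hx => ?_⟩
  have h0 := hc 0 (by simp)
  have h1 := hc x hx
  simp only [intervalIntegral.integral_same, sub_zero] at h0 h1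
  rw [h0, ← h1]; ring

/-! ### The boundary value problems on `(0,1)` -/

theorem exists_isC1Rep {u : ℝ → ℂ} (hu : ContDiff ℝ 1 u) : ∃ F : L2I, IsC1Rep F u := by
  have hm : MemLp u 2 (volume.restrict (Ioo (0 : ℝ) 1)) := by
    obtain ⟨C, hC⟩ := isCompact_Icc.exists_bound_of_continuousOn
      (hu.continuous.continuousOn (s := Icc (0 : ℝ) 1))
    refine MemLp.of_bound hu.continuous.aestronglyMeasurable C ?_
    rw [ae_restrict_iff' measurableSet_Ioo]
    exact Filter.Eventually.of_forall fun x hx => hC x (Ioo_subset_Icc_self hx)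
  exact ⟨hm.toLp u, hu, hm.coeFn_toLp⟩

theorem exists_hasWeakSecondDeriv {u : ℝ → ℂ} (hu : ContDiff ℝ 1 u) {f : L2I} {z : ℂ}
    (h : IsPrimitive (deriv u) (fun x => -f x - z * u x)) :
    ∃ F : L2I, IsC1Rep F u ∧ HasWeakSecondDeriv F (-(f + z • F)) := by
  obtain ⟨F, hF⟩ := exists_isC1Rep hu
  refine ⟨F, hF, hF.hasWeakSecondDeriv (h.congr (fun x _ => rfl) ?_)⟩
  filter_upwards [Lp.coeFn_neg (f + z • F), Lp.coeFn_add f (z • F), Lp.coeFn_smul z F, hF.2]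
    with x h1 h2 h3 h4
  rw [h1, Pi.neg_apply, h2, Pi.add_apply, h3, Pi.smul_apply, h4, smul_eq_mul]
  ring

theorem hasDerivAt_sin_mul (w : ℂ) (x : ℝ) :
    HasDerivAt (fun x : ℝ => Complex.sin (w * x)) (w * Complex.cos (w * x)) x := by
  have h := ((Complex.hasDerivAt_sin (w * x)).comp (x : ℂ)
    ((hasDerivAt_id (x : ℂ)).const_mul w)).comp_ofReal
  simpa [mul_comm] using h

theorem hasDerivAt_cos_mul (w : ℂ) (x : ℝ) :
    HasDerivAt (fun x : ℝ => Complex.cos (w * x)) (-(w * Complex.sin (w * x))) x := by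
  have h := ((Complex.hasDerivAt_cos (w * x)).comp (x : ℂ)
    ((hasDerivAt_id (x : ℂ)).const_mul w)).comp_ofReal
  simpa [mul_comm] using h

theorem hasDerivAt_exp_mul (w : ℂ) (x : ℝ) :
    HasDerivAt (fun x : ℝ => Complex.exp (w * x)) (w * Complex.exp (w * x)) x := by
  have h := ((Complex.hasDerivAt_exp (w * x)).comp (x : ℂ)
    ((hasDerivAt_id (x : ℂ)).const_mul w)).comp_ofReal
  simpa [mul_comm] using h

theorem deriv_sin_mul (w : ℂ) :
    deriv (fun x : ℝ => Complex.sin (w * x)) = fun x : ℝ => w * Complex.cos (w * x) :=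
  funext fun x => (hasDerivAt_sin_mul w x).deriv

theorem deriv_cos_mul (w : ℂ) :
    deriv (fun x : ℝ => Complex.cos (w * x)) = fun x : ℝ => -(w * Complex.sin (w * x)) :=
  funext fun x => (hasDerivAt_cos_mul w x).deriv

theorem contDiff_sin_mul (w : ℂ) : ContDiff ℝ 1 fun x : ℝ => Complex.sin (w * x) :=
  contDiff_one_iff_deriv.2 ⟨fun x => (hasDerivAt_sin_mul w x).differentiableAt, by
    rw [deriv_sin_mul]; fun_prop⟩

theorem contDiff_cos_mul (w : ℂ) : ContDiff ℝ 1 fun x : ℝ => Complex.cos (w * x) :=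
  contDiff_one_iff_deriv.2 ⟨fun x => (hasDerivAt_cos_mul w x).differentiableAt, by
    rw [deriv_cos_mul]; fun_prop⟩

theorem isPrimitive_deriv_sin_mul (w : ℂ) :
    IsPrimitive (deriv fun x : ℝ => Complex.sin (w * x))
      (fun x => -w ^ 2 * Complex.sin (w * x)) := by
  rw [deriv_sin_mul]
  exact .of_hasDerivAt
    (fun x => ((hasDerivAt_cos_mul w x).const_mul w).congr_deriv (by ring)) (by fun_prop)

theorem isPrimitive_deriv_cos_mul (w : ℂ) :
    IsPrimitive (deriv fun x : ℝ => Complex.cos (w * x))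
      (fun x => -w ^ 2 * Complex.cos (w * x)) := by
  rw [deriv_cos_mul]
  exact .of_hasDerivAt
    (fun x => ((hasDerivAt_sin_mul w x).const_mul w).neg.congr_deriv (by ring)) (by fun_prop)

theorem exists_isC1Rep_sin (w : ℂ) : ∃ F : L2I, IsC1Rep F (fun x => Complex.sin (w * x)) ∧
    HasWeakSecondDeriv F (-(w ^ 2 • F)) := by
  obtain ⟨F, h1, h2⟩ := exists_hasWeakSecondDeriv (contDiff_sin_mul w) (f := 0) (z := w ^ 2)
    ((isPrimitive_deriv_sin_mul w).congr (fun _ _ => rfl) (by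
      filter_upwards [Lp.coeFn_zero ℂ 2 (volume.restrict (Ioo (0 : ℝ) 1))] with x hx
      rw [hx, Pi.zero_apply]; ring))
  exact ⟨F, h1, by simpa using h2⟩

theorem exists_isC1Rep_cos (w : ℂ) : ∃ F : L2I, IsC1Rep F (fun x => Complex.cos (w * x)) ∧
    HasWeakSecondDeriv F (-(w ^ 2 • F)) := by
  obtain ⟨F, h1, h2⟩ := exists_hasWeakSecondDeriv (contDiff_cos_mul w) (f := 0) (z := w ^ 2)
    ((isPrimitive_deriv_cos_mul w).congr (fun _ _ => rfl) (by
      filter_upwards [Lp.coeFn_zero ℂ 2 (volume.restrict (Ioo (0 : ℝ) 1))] with x hx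
      rw [hx, Pi.zero_apply]; ring))
  exact ⟨F, h1, by simpa using h2⟩

/-- The initial value problem `-u'' - w² u = f`, `u(0) = u'(0) = 0`. -/
theorem exists_solution_initial (w : ℂ) (f : L2I) :
    ∃ u : ℝ → ℂ, ContDiff ℝ 1 u ∧ u 0 = 0 ∧ deriv u 0 = 0 ∧
      IsPrimitive (deriv u) (fun x => -f x - w ^ 2 * u x) := by
  -- Since `k² = -w²`, the equation factors as `(∂ - k)(∂ + k) u = -f`. With `ψ = u' + k u` it
  -- becomes two first-order equations, each solved by an exponential integrating factor.
  set k : ℂ := Complex.I * w with hk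
  have hk2 : k ^ 2 = -w ^ 2 := by rw [hk, mul_pow, Complex.I_sq]; ring
  -- Extension by zero makes the solution `C¹` on all of `ℝ`, as `IsC1Rep` demands.
  set f₀ : ℝ → ℂ := (Ioo (0 : ℝ) 1).indicator f with hf₀
  have hf₀i : Integrable f₀ :=
    (integrable_indicator_iff measurableSet_Ioo).2 ((Lp.memLp f).integrable (by norm_num))
  have hexp (c : ℂ) : Continuous fun x : ℝ => Complex.exp (c * x) := by fun_prop
  have hint (x y : ℝ) : IntervalIntegrable (fun t => Complex.exp (-k * t) * f₀ t) volume x y :=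
    hf₀i.intervalIntegrable.continuousOn_mul (hexp _).continuousOn
  set E : ℝ → ℂ := fun x => ∫ t in (0 : ℝ)..x, Complex.exp (-k * t) * f₀ t with hE
  have hEc : Continuous E := intervalIntegral.continuous_primitive hint 0
  have hEp : IsPrimitive E (fun t => Complex.exp (-k * t) * f₀ t) :=
    ⟨hint 0 1, fun x _ => by simp [hE]⟩
  set ψ : ℝ → ℂ := fun x => -(Complex.exp (k * x) * E x) with hψ
  have hψc : Continuous ψ := ((hexp k).mul hEc).neg
  have hψp : IsPrimitive ψ (fun x => k * ψ x - f₀ x) := by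
    have h := (((IsPrimitive.of_hasDerivAt (hasDerivAt_exp_mul k)
      (by fun_prop)).mul hEp).const_mul (-1))
    refine h.congr (fun x _ => by simp [hψ]) (Filter.Eventually.of_forall fun x => ?_)
    have e : Complex.exp (k * x) * Complex.exp (-k * x) = 1 := by
      rw [← Complex.exp_add]; simp
    simp only [hψ]
    linear_combination f₀ x * e
  have hc : Continuous fun t : ℝ => Complex.exp (k * t) * ψ t := (hexp k).mul hψc
  set u : ℝ → ℂ := fun x => Complex.exp (-k * x) * ∫ t in (0 : ℝ)..x, Complex.exp (k * t) * ψ t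
    with hu
  have hud (x : ℝ) : HasDerivAt u (ψ x - k * u x) x := by
    have h1 := (hasDerivAt_exp_mul (-k) x).mul
      (intervalIntegral.integral_hasDerivAt_right (hc.intervalIntegrable 0 x)
        (hc.stronglyMeasurableAtFilter _ _) hc.continuousAt)
    refine h1.congr_deriv ?_
    have e : Complex.exp (-k * x) * Complex.exp (k * x) = 1 := by
      rw [← Complex.exp_add]; simp
    simp only [hu]
    linear_combination ψ x * e
  have hde : deriv u = fun x => ψ x - k * u x := funext fun x => (hud x).deriv
  have huc : Continuous u := continuous_iff_continuousAt.2 fun x => (hud x).continuousAt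
  have hdc : Continuous fun x => ψ x - k * u x := hψc.sub (huc.const_mul k)
  have hu1 : ContDiff ℝ 1 u :=
    contDiff_one_iff_deriv.2 ⟨fun x => (hud x).differentiableAt, by rwa [hde]⟩
  refine ⟨u, hu1, by simp [hu], by rw [hde]; simp [hu, hψ, hE], ?_⟩
  have h := hψp.add ((IsPrimitive.of_hasDerivAt hud hdc).const_mul (-k))
  refine h.congr (fun x _ => by rw [hde]; ring) ?_
  rw [ae_restrict_iff' measurableSet_Ioo]
  refine Filter.Eventually.of_forall fun x hx => ?_
  rw [hf₀, indicator_of_mem hx]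
  linear_combination -u x * hk2

theorem exists_dirichlet_solution {w : ℂ} (hw : Complex.sin w ≠ 0) (f : L2I) :
    ∃ F ∈ dirichletDomain, HasWeakSecondDeriv F (-(f + w ^ 2 • F)) := by
  obtain ⟨u, h1, h2, -, h4⟩ := exists_solution_initial w f
  -- The homogeneous solution `sin (w x)` keeps the value at `0`, and this multiple cancels the
  -- value at `1`.
  set C := -u 1 / Complex.sin w with hC
  have hs := (contDiff_sin_mul w)
  have hv : ContDiff ℝ 1 fun x : ℝ => u x + C * Complex.sin (w * x) :=
    h1.add (contDiff_const.mul hs)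
  have hdv : deriv (fun x : ℝ => u x + C * Complex.sin (w * x)) =
      fun x => deriv u x + C * deriv (fun x : ℝ => Complex.sin (w * x)) x := by
    funext x
    exact ((h1.differentiable one_ne_zero x).hasDerivAt.add
      ((hs.differentiable one_ne_zero x).hasDerivAt.const_mul C)).deriv
  obtain ⟨F, hF, hF'⟩ := exists_hasWeakSecondDeriv hv (f := f) (z := w ^ 2) (by
    rw [hdv]
    refine (h4.add ((isPrimitive_deriv_sin_mul w).const_mul C)).congr (fun _ _ => rfl)
      (Filter.Eventually.of_forall fun x => by ring))
  refine ⟨F, ⟨⟨_, hF'⟩, _, hF, by simp [h2], ?_⟩, hF'⟩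
  simp only [hC, Complex.ofReal_one, mul_one]
  field_simp
  ring

theorem exists_neumann_solution {w : ℂ} (hw0 : w ≠ 0) (hw : Complex.sin w ≠ 0) (f : L2I) :
    ∃ F ∈ neumannDomain, HasWeakSecondDeriv F (-(f + w ^ 2 • F)) := by
  obtain ⟨u, h1, -, h3, h4⟩ := exists_solution_initial w f
  -- `cos (w x)` has slope `0` at `0` and `-w sin w` at `1`, so this multiple cancels `u'(1)`.
  set C := deriv u 1 / (w * Complex.sin w) with hC
  have hs := (contDiff_cos_mul w)
  have hv : ContDiff ℝ 1 fun x : ℝ => u x + C * Complex.cos (w * x) :=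
    h1.add (contDiff_const.mul hs)
  have hdv : deriv (fun x : ℝ => u x + C * Complex.cos (w * x)) =
      fun x => deriv u x + C * deriv (fun x : ℝ => Complex.cos (w * x)) x := by
    funext x
    exact ((h1.differentiable one_ne_zero x).hasDerivAt.add
      ((hs.differentiable one_ne_zero x).hasDerivAt.const_mul C)).deriv
  obtain ⟨F, hF, hF'⟩ := exists_hasWeakSecondDeriv hv (f := f) (z := w ^ 2) (by
    rw [hdv]
    refine (h4.add ((isPrimitive_deriv_cos_mul w).const_mul C)).congr (fun _ _ => rfl)
      (Filter.Eventually.of_forall fun x => by ring))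
  refine ⟨F, ⟨⟨_, hF'⟩, _, hF, by rw [hdv]; simp [h3, deriv_cos_mul], ?_⟩, hF'⟩
  rw [hdv]
  simp only [hC, deriv_cos_mul, Complex.ofReal_one, mul_one]
  field_simp
  ring

theorem sin_ne_zero_of_sq_ne {w : ℂ} (h : ∀ n : ℕ, w ^ 2 ≠ ((Real.pi ^ 2 * (n : ℝ) ^ 2 : ℝ) : ℂ)) :
    Complex.sin w ≠ 0 := by
  intro h0
  obtain ⟨n, rfl⟩ := Complex.sin_eq_zero_iff.1 h0
  apply h n.natAbs
  have e : ((n.natAbs : ℕ) : ℝ) ^ 2 = (n : ℝ) ^ 2 := by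
    rw [Nat.cast_natAbs, Int.cast_abs, sq_abs]
  rw [e]
  push_cast
  ring

/-- Green's first identity. -/
theorem inner_neg_weakSecondDeriv {f g h : L2I} {u v : ℝ → ℂ} (hw : HasWeakSecondDeriv f g)
    (hu : IsC1Rep f u) (hv : IsC1Rep h v) (h0 : starRingEnd ℂ (v 0) * deriv u 0 = 0)
    (h1 : starRingEnd ℂ (v 1) * deriv u 1 = 0) :
    inner ℂ h (-g) = ∫ x in (0 : ℝ)..1, starRingEnd ℂ (deriv v x) * deriv u x := by
  have hp := hw.isPrimitive_deriv hu
  have hq := (IsPrimitive.of_contDiff hv.1).conj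
  have key := (hq.mul hp).integral_eq
  rw [h0, h1, intervalIntegral.integral_add (hq.1.mul_continuousOn hp.continuousOn)
    (hp.1.continuousOn_mul hq.continuousOn)] at key
  rw [inner_neg_right, L2.inner_def, eq_comm, ← sub_zero (∫ x in (0 : ℝ)..1, _), ← sub_zero (0 : ℂ)]
  have e : ∫ x in Ioo (0 : ℝ) 1, inner ℂ (h x) (g x) =
      ∫ x in (0 : ℝ)..1, starRingEnd ℂ (v x) * g x := by
    rw [← setIntegral_Ioo_eq_intervalIntegral]
    refine integral_congr_ae ?_
    filter_upwards [hv.2] with x hx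
    rw [RCLike.inner_apply, hx, mul_comm]
  rw [e]
  linear_combination key

/-! ### Symmetric nonnegative operators -/

section Abstract

variable {E : Type*} [NormedAddCommGroup E] [InnerProductSpace ℂ E]

theorem IsResolventAt.eq_zero_of_apply_eq {T : E →ₗ.[ℂ] E} {z : ℂ} {R : E →L[ℂ] E}
    (hR : IsResolventAt T z R) (x : T.domain) (hx : T x = z • (x : E)) : (x : E) = 0 := by
  rw [← hR.2 x, hx, sub_self, map_zero]

/-- A symmetric operator for which `T - z` and `T - z̄` are onto has a bounded resolvent at `z`. -/
theorem exists_isResolventAt_of_isFormalAdjoint [CompleteSpace E] {T : E →ₗ.[ℂ] E}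
    (hT : T.IsFormalAdjoint T) {z : ℂ} (h1 : ∀ y, ∃ x : T.domain, T x - z • (x : E) = y)
    (h2 : ∀ y, ∃ x : T.domain, T x - starRingEnd ℂ z • (x : E) = y) :
    ∃ R : E →L[ℂ] E, IsResolventAt T z R := by
  have hadj (x y : T.domain) : inner ℂ (T x - starRingEnd ℂ z • (x : E)) (y : E) =
      inner ℂ (x : E) (T y - z • (y : E)) := by
    rw [inner_sub_left, inner_sub_right, inner_smul_left, inner_smul_right, hT x y,
      Complex.conj_conj]
  -- Surjectivity of `T - z̄` writes `x - y` as `(T - z̄) v`; moving `T - z̄` across the inner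
  -- product gives `‖x - y‖² = 0`.
  have hinj (x y : T.domain) (h : T x - z • (x : E) = T y - z • (y : E)) : x = y := by
    obtain ⟨v, hv⟩ := h2 (x - y : E)
    have e1 := hadj v x
    have e2 := hadj v y
    rw [h, ← e2, hv] at e1
    rw [← sub_eq_zero, ← inner_sub_right, inner_self_eq_zero, sub_eq_zero] at e1
    exact Subtype.ext e1
  choose r hr using h1
  let L : E →ₗ[ℂ] E :=
    { toFun := fun y => r y
      map_add' := fun y y' => by
        rw [← Submodule.coe_add]
        congr 1
        apply hinj
        rw [hr, LinearPMap.map_add, Submodule.coe_add, smul_add, add_sub_add_comm, hr, hr]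
      map_smul' := fun c y => by
        rw [RingHom.id_apply, ← Submodule.coe_smul]
        congr 1
        apply hinj
        rw [hr, LinearPMap.map_smul, Submodule.coe_smul, smul_comm, ← smul_sub, hr] }
  -- Closed graph theorem: the weak form `⟨(T - z̄) w, L t⟩ = ⟨w, t⟩` passes to limits, and the
  -- vectors `(T - z̄) w` exhaust `E`.
  have hL : Continuous L := by
    refine L.continuous_of_seq_closed_graph fun u x y hu hv => ?_
    refine ext_inner_left ℂ fun v => ?_
    obtain ⟨w, rfl⟩ := h2 v
    have e (t : E) : inner ℂ (T w - starRingEnd ℂ z • (w : E)) (L t) = inner ℂ (w : E) t := by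
      exact (hadj w (r t)).trans (by rw [hr])
    refine tendsto_nhds_unique (tendsto_const_nhds.inner hv) ?_
    simp only [Function.comp_apply, e]
    exact tendsto_const_nhds.inner hu
  refine ⟨⟨L, hL⟩, fun y => ⟨(r y).2, hr y⟩, fun x => ?_⟩
  exact congrArg Subtype.val (hinj _ _ (hr _))

/-- Lower bound for `aT - z` by the distance of `z` to the ray through `a`, for `T ≥ 0`. -/
theorem mul_norm_le_of_nonneg {T : E →ₗ.[ℂ] E} {a c : ℝ} {z : ℂ}
    (hT : ∀ x : T.domain, ∃ q : ℝ, 0 ≤ q ∧ inner ℂ (x : E) (T x) = q)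
    (hc : ∀ t : ℝ, 0 ≤ t → c ≤ ‖((a * t : ℝ) : ℂ) - z‖) (x : T.domain) :
    c * ‖(x : E)‖ ≤ ‖(a : ℂ) • T x - z • (x : E)‖ := by
  rcases eq_or_ne (x : E) 0 with h0 | h0
  · rw [h0, norm_zero, mul_zero]
    positivity
  obtain ⟨q, hq, hqx⟩ := hT x
  have hx : 0 < ‖(x : E)‖ := norm_pos_iff.2 h0
  -- The Rayleigh quotient `q / ‖x‖²` is the parameter `t ≥ 0` at which `hc` is used.
  have e : inner ℂ (x : E) ((a : ℂ) • T x - z • (x : E)) =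
      ((((a * (q / ‖(x : E)‖ ^ 2) : ℝ) : ℂ)) - z) * (‖(x : E)‖ ^ 2 : ℝ) := by
    rw [inner_sub_right, inner_smul_right, inner_smul_right, hqx, inner_self_eq_norm_sq_to_K]
    have : (‖(x : E)‖ : ℂ) ≠ 0 := by exact_mod_cast hx.ne'
    push_cast
    rw [sub_mul]
    congr 1
    field_simp
  have h1 := norm_inner_le_norm (𝕜 := ℂ) (x : E) ((a : ℂ) • T x - z • (x : E))
  rw [e, norm_mul, Complex.norm_real, Real.norm_of_nonneg (by positivity)] at h1
  have h2 := hc _ (by positivity : 0 ≤ q / ‖(x : E)‖ ^ 2)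
  have h3 : c * ‖(x : E)‖ ^ 2 ≤ ‖(x : E)‖ * ‖(a : ℂ) • T x - z • (x : E)‖ :=
    (mul_le_mul_of_nonneg_right h2 (by positivity)).trans h1
  nlinarith

end Abstract

/-! ### The Dirichlet and the Neumann Laplacian -/

/-- The operator `f ↦ -f''` with a domain contained in `W^{2,2}(0,1)`. -/
noncomputable def negSecondDeriv (V : Submodule ℂ L2I) (hV : V ≤ sobolevTwo) : L2I →ₗ.[ℂ] L2I where
  domain := V
  toFun := -(secondDeriv ∘ₗ Submodule.inclusion hV)

theorem negSecondDeriv_apply {V : Submodule ℂ L2I} (hV : V ≤ sobolevTwo)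
    (x : (negSecondDeriv V hV).domain) :
    negSecondDeriv V hV x = -secondDeriv ⟨x, hV x.2⟩ := rfl

theorem hasWeakSecondDeriv_negSecondDeriv {V : Submodule ℂ L2I} (hV : V ≤ sobolevTwo)
    (x : (negSecondDeriv V hV).domain) :
    HasWeakSecondDeriv (x : L2I) (-negSecondDeriv V hV x) := by
  rw [negSecondDeriv_apply, neg_neg]
  exact secondDeriv_spec ⟨x, hV x.2⟩

theorem negSecondDeriv_eq {V : Submodule ℂ L2I} (hV : V ≤ sobolevTwo)
    (x : (negSecondDeriv V hV).domain) {g : L2I} (h : HasWeakSecondDeriv (x : L2I) g) :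
    negSecondDeriv V hV x = -g :=
  neg_eq_iff_eq_neg.1 ((hasWeakSecondDeriv_negSecondDeriv hV x).unique h)

/-- Green's identity for both orders of the pair. The predicate `B` stands for the boundary
condition, and `hB'` says that the boundary terms vanish, so Dirichlet and Neumann are treated at
once. -/
theorem negSecondDeriv_isFormalAdjoint {V : Submodule ℂ L2I} (hV : V ≤ sobolevTwo)
    {B : (ℝ → ℂ) → Prop} (hB : ∀ f ∈ V, ∃ u, IsC1Rep f u ∧ B u)
    (hB' : ∀ u v, B u → B v → starRingEnd ℂ (v 0) * deriv u 0 = 0 ∧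
      starRingEnd ℂ (v 1) * deriv u 1 = 0) :
    (negSecondDeriv V hV).IsFormalAdjoint (negSecondDeriv V hV) := by
  intro x y
  obtain ⟨u, hu, hu'⟩ := hB x x.2
  obtain ⟨v, hv, hv'⟩ := hB y y.2
  have h1 := inner_neg_weakSecondDeriv (hasWeakSecondDeriv_negSecondDeriv hV x) hu hv
    (hB' u v hu' hv').1 (hB' u v hu' hv').2
  have h2 := inner_neg_weakSecondDeriv (hasWeakSecondDeriv_negSecondDeriv hV y) hv hu
    (hB' v u hv' hu').1 (hB' v u hv' hu').2
  rw [neg_neg] at h1 h2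
  rw [h2, ← inner_conj_symm, h1]
  have := Complex.conjCLE.toContinuousLinearMap.intervalIntegral_comp_comm (a := 0) (b := 1)
    (f := fun x => starRingEnd ℂ (deriv v x) * deriv u x) (μ := volume)
    (((Complex.continuous_conj.comp (hv.1.continuous_deriv le_rfl)).mul
      (hu.1.continuous_deriv le_rfl)).intervalIntegrable _ _)
  simp only [ContinuousLinearEquiv.coe_coe, Complex.conjCLE_apply, map_mul, Complex.conj_conj]
    at this
  rw [← this]
  simp only [mul_comm]

theorem negSecondDeriv_nonneg {V : Submodule ℂ L2I} (hV : V ≤ sobolevTwo)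
    {B : (ℝ → ℂ) → Prop} (hB : ∀ f ∈ V, ∃ u, IsC1Rep f u ∧ B u)
    (hB' : ∀ u v, B u → B v → starRingEnd ℂ (v 0) * deriv u 0 = 0 ∧
      starRingEnd ℂ (v 1) * deriv u 1 = 0)
    (x : (negSecondDeriv V hV).domain) :
    ∃ q : ℝ, 0 ≤ q ∧ inner ℂ (x : L2I) (negSecondDeriv V hV x) = q := by
  obtain ⟨u, hu, hu'⟩ := hB x x.2
  have h1 := inner_neg_weakSecondDeriv (hasWeakSecondDeriv_negSecondDeriv hV x) hu hu
    (hB' u u hu' hu').1 (hB' u u hu' hu').2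
  rw [neg_neg] at h1
  refine ⟨∫ x in (0 : ℝ)..1, ‖deriv u x‖ ^ 2,
    intervalIntegral.integral_nonneg zero_le_one fun _ _ => by positivity, ?_⟩
  rw [h1, ← intervalIntegral.integral_ofReal]
  congr 1 with x
  rw [mul_comm, Complex.mul_conj, Complex.normSq_eq_norm_sq]

theorem dirichletDomain_le : dirichletDomain ≤ sobolevTwo := fun _ h => h.1

theorem neumannDomain_le : neumannDomain ≤ sobolevTwo := fun _ h => h.1

/-- `-d²/dx²` on `(0,1)` with Dirichlet conditions. -/
noncomputable abbrev dirichletLaplacian : L2I →ₗ.[ℂ] L2I := negSecondDeriv dirichletDomain dirichletDomain_le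

/-- `-d²/dx²` on `(0,1)` with Neumann conditions. -/
noncomputable abbrev neumannLaplacian : L2I →ₗ.[ℂ] L2I := negSecondDeriv neumannDomain neumannDomain_le

theorem dirichlet_boundary (u v : ℝ → ℂ) (_ : u 0 = 0 ∧ u 1 = 0) (hv : v 0 = 0 ∧ v 1 = 0) :
    starRingEnd ℂ (v 0) * deriv u 0 = 0 ∧ starRingEnd ℂ (v 1) * deriv u 1 = 0 := by
  simp [hv]

theorem neumann_boundary (u v : ℝ → ℂ) (hu : deriv u 0 = 0 ∧ deriv u 1 = 0)
    (_ : deriv v 0 = 0 ∧ deriv v 1 = 0) :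
    starRingEnd ℂ (v 0) * deriv u 0 = 0 ∧ starRingEnd ℂ (v 1) * deriv u 1 = 0 := by
  simp [hu]

theorem dirichletLaplacian_isFormalAdjoint :
    dirichletLaplacian.IsFormalAdjoint dirichletLaplacian :=
  negSecondDeriv_isFormalAdjoint dirichletDomain_le (fun _ hf => hf.2) dirichlet_boundary

theorem neumannLaplacian_isFormalAdjoint :
    neumannLaplacian.IsFormalAdjoint neumannLaplacian :=
  negSecondDeriv_isFormalAdjoint neumannDomain_le (fun _ hf => hf.2) neumann_boundary

theorem dirichletLaplacian_nonneg (x : dirichletLaplacian.domain) :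
    ∃ q : ℝ, 0 ≤ q ∧ inner ℂ (x : L2I) (dirichletLaplacian x) = q :=
  negSecondDeriv_nonneg dirichletDomain_le (fun _ hf => hf.2) dirichlet_boundary x

theorem neumannLaplacian_nonneg (x : neumannLaplacian.domain) :
    ∃ q : ℝ, 0 ≤ q ∧ inner ℂ (x : L2I) (neumannLaplacian x) = q :=
  negSecondDeriv_nonneg neumannDomain_le (fun _ hf => hf.2) neumann_boundary x

theorem dirichletLaplacian_surjective {z : ℂ}
    (hz : ∀ n : ℕ, z ≠ ((Real.pi ^ 2 * (n : ℝ) ^ 2 : ℝ) : ℂ)) (f : L2I) :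
    ∃ x : dirichletLaplacian.domain, dirichletLaplacian x - z • (x : L2I) = f := by
  obtain ⟨w, rfl⟩ := IsAlgClosed.exists_pow_nat_eq z (n := 2) (by norm_num)
  obtain ⟨F, hF, h⟩ := exists_dirichlet_solution (sin_ne_zero_of_sq_ne hz) f
  refine ⟨⟨F, hF⟩, ?_⟩
  rw [negSecondDeriv_eq dirichletDomain_le ⟨F, hF⟩ h]
  simp

theorem neumannLaplacian_surjective {z : ℂ}
    (hz : ∀ n : ℕ, z ≠ ((Real.pi ^ 2 * (n : ℝ) ^ 2 : ℝ) : ℂ)) (f : L2I) :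
    ∃ x : neumannLaplacian.domain, neumannLaplacian x - z • (x : L2I) = f := by
  obtain ⟨w, rfl⟩ := IsAlgClosed.exists_pow_nat_eq z (n := 2) (by norm_num)
  have hw0 : w ≠ 0 := by
    rintro rfl
    exact hz 0 (by simp)
  obtain ⟨F, hF, h⟩ := exists_neumann_solution hw0 (sin_ne_zero_of_sq_ne hz) f
  refine ⟨⟨F, hF⟩, ?_⟩
  rw [negSecondDeriv_eq neumannDomain_le ⟨F, hF⟩ h]
  simp

theorem conj_ne_of_ne {z : ℂ} (hz : ∀ n : ℕ, z ≠ ((Real.pi ^ 2 * (n : ℝ) ^ 2 : ℝ) : ℂ)) (n : ℕ) :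
    starRingEnd ℂ z ≠ ((Real.pi ^ 2 * (n : ℝ) ^ 2 : ℝ) : ℂ) := fun h => hz n (by
  rw [← Complex.conj_conj z, h, Complex.conj_ofReal])

theorem exists_isResolventAt_dirichletLaplacian {z : ℂ}
    (hz : ∀ n : ℕ, z ≠ ((Real.pi ^ 2 * (n : ℝ) ^ 2 : ℝ) : ℂ)) :
    ∃ R : L2I →L[ℂ] L2I, IsResolventAt dirichletLaplacian z R :=
  exists_isResolventAt_of_isFormalAdjoint dirichletLaplacian_isFormalAdjoint
    (dirichletLaplacian_surjective hz) (dirichletLaplacian_surjective (conj_ne_of_ne hz))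

theorem exists_isResolventAt_neumannLaplacian {z : ℂ}
    (hz : ∀ n : ℕ, z ≠ ((Real.pi ^ 2 * (n : ℝ) ^ 2 : ℝ) : ℂ)) :
    ∃ R : L2I →L[ℂ] L2I, IsResolventAt neumannLaplacian z R :=
  exists_isResolventAt_of_isFormalAdjoint neumannLaplacian_isFormalAdjoint
    (neumannLaplacian_surjective hz) (neumannLaplacian_surjective (conj_ne_of_ne hz))

/-- The eigenfunctions `sin(nπx)` of the Dirichlet Laplacian. -/
theorem exists_dirichlet_eigenvector (n : ℕ) : ∃ x : dirichletLaplacian.domain,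
    IsC1Rep x (fun t => Complex.sin (((n * Real.pi : ℝ) : ℂ) * t)) ∧
      dirichletLaplacian x = ((Real.pi ^ 2 * (n : ℝ) ^ 2 : ℝ) : ℂ) • (x : L2I) := by
  obtain ⟨F, h1, h2⟩ := exists_isC1Rep_sin ((n * Real.pi : ℝ) : ℂ)
  have hF : F ∈ dirichletDomain := ⟨⟨_, h2⟩, _, h1, by simp, by simp [Complex.sin_nat_mul_pi]⟩
  refine ⟨⟨F, hF⟩, h1, ?_⟩
  rw [negSecondDeriv_eq dirichletDomain_le ⟨F, hF⟩ h2, neg_neg]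
  congr 1
  push_cast
  ring

/-- The eigenfunctions `cos(nπx)` of the Neumann Laplacian. -/
theorem exists_neumann_eigenvector (n : ℕ) : ∃ x : neumannLaplacian.domain,
    IsC1Rep x (fun t => Complex.cos (((n * Real.pi : ℝ) : ℂ) * t)) ∧
      neumannLaplacian x = ((Real.pi ^ 2 * (n : ℝ) ^ 2 : ℝ) : ℂ) • (x : L2I) := by
  obtain ⟨F, h1, h2⟩ := exists_isC1Rep_cos ((n * Real.pi : ℝ) : ℂ)
  have hF : F ∈ neumannDomain :=
    ⟨⟨_, h2⟩, _, h1, by rw [deriv_cos_mul]; simp, by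
      rw [deriv_cos_mul]; simp [Complex.sin_nat_mul_pi]⟩
  refine ⟨⟨F, hF⟩, h1, ?_⟩
  rw [negSecondDeriv_eq neumannDomain_le ⟨F, hF⟩ h2, neg_neg]
  congr 1
  push_cast
  ring

/-- Continuous functions that agree almost everywhere on `[0,1]` agree on it, endpoints included. -/
theorem IsC1Rep.ne_zero {f : L2I} {u : ℝ → ℂ} (h : IsC1Rep f u) {x : ℝ} (hx : x ∈ Icc (0 : ℝ) 1)
    (hu : u x ≠ 0) : f ≠ 0 := by
  rintro rfl
  refine hu (Measure.eqOn_Icc_of_ae_eq (g := fun _ => 0) volume zero_ne_one ?_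
    h.1.continuous.continuousOn continuousOn_const hx)
  rw [← restrict_Ioo_eq_restrict_Icc]
  filter_upwards [h.2, Lp.coeFn_zero ℂ 2 (volume.restrict (Ioo (0 : ℝ) 1))] with t h1 h2
  rw [← h1, h2, Pi.zero_apply]

theorem dirichlet_eigenvector_ne_zero {n : ℕ} (hn : n ≠ 0) {f : L2I}
    (h : IsC1Rep f (fun t => Complex.sin (((n * Real.pi : ℝ) : ℂ) * t))) : f ≠ 0 := by
  have hn' : (0 : ℝ) < n := by exact_mod_cast Nat.pos_of_ne_zero hn
  have h1 : (1 : ℝ) ≤ n := by exact_mod_cast Nat.pos_of_ne_zero hn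
  -- At this point the argument of the sine is `π/2`.
  refine h.ne_zero (x := 1 / (2 * n)) ⟨by positivity, ?_⟩ ?_
  · rw [div_le_one (by positivity)]
    linarith
  · rw [← Complex.ofReal_mul, ← Complex.ofReal_sin,
      show (n * Real.pi * (1 / (2 * n)) : ℝ) = Real.pi / 2 by field_simp]
    simp

theorem neumann_eigenvector_ne_zero {n : ℕ} {f : L2I}
    (h : IsC1Rep f (fun t => Complex.cos (((n * Real.pi : ℝ) : ℂ) * t))) : f ≠ 0 :=
  h.ne_zero (x := 0) (by simp) (by simp)

/-! ### The operator `A₂D` and its resolvent -/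

theorem opA2D_apply_zero {a d : ℝ} (x : (opA2D a d).domain) :
    (opA2D a d x) 0 = (a : ℂ) • dirichletLaplacian ⟨(x : L2I2) 0, x.2.1⟩ := by
  rw [negSecondDeriv_apply, smul_neg]
  change -∑ j, _ = _
  simp [Fin.sum_univ_two, matA2]

theorem opA2D_apply_one {a d : ℝ} (x : (opA2D a d).domain) :
    (opA2D a d x) 1 = dirichletLaplacian ⟨(x : L2I2) 0, x.2.1⟩ +
      (d : ℂ) • neumannLaplacian ⟨(x : L2I2) 1, x.2.2⟩ := by
  rw [negSecondDeriv_apply, negSecondDeriv_apply, smul_neg, ← neg_add]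
  change -∑ j, _ = _
  simp [Fin.sum_univ_two, matA2]

theorem L2I2_ext {x y : L2I2} (h0 : x 0 = y 0) (h1 : x 1 = y 1) : x = y := by
  ext1 i
  fin_cases i
  · exact h0
  · exact h1

theorem L2I2_norm_le (x : L2I2) : ‖x‖ ≤ ‖x 0‖ + ‖x 1‖ := by
  rw [PiLp.norm_eq_of_L2, Fin.sum_univ_two, Real.sqrt_le_left (by positivity)]
  nlinarith [mul_nonneg (norm_nonneg (x 0)) (norm_nonneg (x 1))]

/-- Forward substitution in the triangular system: `P` returns `φ`, and `Q` returns `γ` after `L_D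
φ` has been replaced by the bounded expression `a⁻¹ (f + z φ)`. -/
theorem exists_isResolventAt_opA2D {a d : ℝ} (ha : a ≠ 0) (hd : d ≠ 0) {z : ℂ}
    {RD RN : L2I →L[ℂ] L2I} (hD : IsResolventAt dirichletLaplacian (z / a) RD)
    (hN : IsResolventAt neumannLaplacian (z / d) RN) :
    ∃ R : L2I2 →L[ℂ] L2I2, IsResolventAt (opA2D a d) z R := by
  have ha' : (a : ℂ) ≠ 0 := by exact_mod_cast ha
  have hd' : (d : ℂ) ≠ 0 := by exact_mod_cast hd
  let P : L2I2 →L[ℂ] L2I := (a : ℂ)⁻¹ • RD.comp (PiLp.proj 2 (fun _ : Fin 2 => L2I) 0)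
  let Q : L2I2 →L[ℂ] L2I := (d : ℂ)⁻¹ • RN.comp (PiLp.proj 2 (fun _ : Fin 2 => L2I) 1 -
    (a : ℂ)⁻¹ • (PiLp.proj 2 (fun _ : Fin 2 => L2I) 0 + z • P))
  let R : L2I2 →L[ℂ] L2I2 :=
    ((PiLp.continuousLinearEquiv 2 ℂ (fun _ : Fin 2 => L2I)).symm :
      (Fin 2 → L2I) →L[ℂ] L2I2).comp (ContinuousLinearMap.pi ![P, Q])
  have hR0 (y : L2I2) : R y 0 = (a : ℂ)⁻¹ • RD (y 0) := rfl
  have hR1 (y : L2I2) : R y 1 =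
      (d : ℂ)⁻¹ • RN (y 1 - (a : ℂ)⁻¹ • (y 0 + z • (a : ℂ)⁻¹ • RD (y 0))) := rfl
  refine ⟨R, fun y => ?_, fun x => ?_⟩
  · obtain ⟨h1, h2⟩ := hD.1 (y 0)
    obtain ⟨h3, h4⟩ := hN.1 (y 1 - (a : ℂ)⁻¹ • (y 0 + z • (a : ℂ)⁻¹ • RD (y 0)))
    have hm : R y ∈ (opA2D a d).domain :=
      ⟨Submodule.smul_mem _ _ h1, Submodule.smul_mem _ _ h3⟩
    have e0 : dirichletLaplacian ⟨R y 0, hm.1⟩ = (a : ℂ)⁻¹ • dirichletLaplacian ⟨_, h1⟩ :=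
      dirichletLaplacian.map_smul _ ⟨_, h1⟩
    have e1 : neumannLaplacian ⟨R y 1, hm.2⟩ = (d : ℂ)⁻¹ • neumannLaplacian ⟨_, h3⟩ :=
      neumannLaplacian.map_smul _ ⟨_, h3⟩
    rw [sub_eq_iff_eq_add] at h2 h4
    refine ⟨hm, L2I2_ext ?_ ?_⟩
    · rw [PiLp.sub_apply, PiLp.smul_apply, opA2D_apply_zero, e0, h2, hR0]
      match_scalars <;> field_simp
      ring
    · rw [PiLp.sub_apply, PiLp.smul_apply, opA2D_apply_one, e0, e1, h4, h2, hR1]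
      match_scalars <;> field_simp <;> ring
  · have h0 : R (opA2D a d x - z • (x : L2I2)) 0 = (x : L2I2) 0 := by
      rw [hR0, ← map_smul, PiLp.sub_apply, PiLp.smul_apply, opA2D_apply_zero]
      refine Eq.trans ?_ (hD.2 ⟨(x : L2I2) 0, x.2.1⟩)
      congr 1
      match_scalars <;> field_simp
    refine L2I2_ext h0 ?_
    rw [hR0] at h0
    rw [hR1, h0, ← map_smul, PiLp.sub_apply, PiLp.smul_apply, PiLp.sub_apply, PiLp.smul_apply,
      opA2D_apply_zero, opA2D_apply_one]
    refine Eq.trans ?_ (hN.2 ⟨(x : L2I2) 1, x.2.2⟩)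
    congr 1
    match_scalars <;> field_simp <;> ring

/-- The values `aπ²n²`, `n = 0, 1, 2, …`. -/
def scaledSquares (a : ℝ) : Set ℂ := {z | ∃ n : ℕ, z = ((a * Real.pi ^ 2 * (n : ℝ) ^ 2 : ℝ) : ℂ)}

theorem div_ne_of_notMem_scaledSquares {a : ℝ} (ha : a ≠ 0) {z : ℂ} (hz : z ∉ scaledSquares a)
    (n : ℕ) : z / a ≠ ((Real.pi ^ 2 * (n : ℝ) ^ 2 : ℝ) : ℂ) := by
  have ha' : (a : ℂ) ≠ 0 := by exact_mod_cast ha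
  intro h
  rw [div_eq_iff ha'] at h
  exact hz ⟨n, by rw [h]; push_cast; ring⟩

theorem exists_isResolventAt_of_notMem {a d : ℝ} (ha : a ≠ 0) (hd : d ≠ 0) {z : ℂ}
    (hza : z ∉ scaledSquares a) (hzd : z ∉ scaledSquares d) :
    ∃ R : L2I2 →L[ℂ] L2I2, IsResolventAt (opA2D a d) z R := by
  obtain ⟨RD, hD⟩ := exists_isResolventAt_dirichletLaplacian (div_ne_of_notMem_scaledSquares ha hza)
  obtain ⟨RN, hN⟩ := exists_isResolventAt_neumannLaplacian (div_ne_of_notMem_scaledSquares hd hzd)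
  exact exists_isResolventAt_opA2D ha hd hD hN

/-- The vector `(0, cos nπx)` is an eigenvector. -/
theorem not_isResolventAt_of_mem_right {a d : ℝ} {z : ℂ} (hz : z ∈ scaledSquares d)
    (R : L2I2 →L[ℂ] L2I2) : ¬ IsResolventAt (opA2D a d) z R := by
  obtain ⟨n, rfl⟩ := hz
  intro hR
  obtain ⟨x, h1, h2⟩ := exists_neumann_eigenvector n
  let v : (opA2D a d).domain := ⟨WithLp.toLp 2 ![0, (x : L2I)], zero_mem _, x.2⟩
  have e0 : dirichletLaplacian ⟨(v : L2I2) 0, v.2.1⟩ = 0 := dirichletLaplacian.map_zero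
  have e1 : neumannLaplacian ⟨(v : L2I2) 1, v.2.2⟩ = _ := h2
  have hv := hR.eq_zero_of_apply_eq v (L2I2_ext
    (by rw [opA2D_apply_zero, e0, smul_zero]; exact (smul_zero (A := L2I) (_ : ℂ)).symm) (by
      rw [opA2D_apply_one, e0, e1, PiLp.smul_apply, zero_add, smul_smul]
      change _ = _ • (x : L2I)
      congr 1
      push_cast
      ring))
  exact neumann_eigenvector_ne_zero h1 (congrArg (fun y : L2I2 => y 1) hv)

/-- The sine need not extend to an eigenvector because of the coupling, so surjectivity is refuted
instead: by symmetry the first component of the range is orthogonal to `sin nπx`. For `n = 0` the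
sine vanishes, but `0` is also one of the values `dπ²n²`. -/
theorem not_isResolventAt_of_mem_left {a d : ℝ} {z : ℂ} (hz : z ∈ scaledSquares a)
    (R : L2I2 →L[ℂ] L2I2) : ¬ IsResolventAt (opA2D a d) z R := by
  obtain ⟨n, rfl⟩ := hz
  rcases eq_or_ne n 0 with rfl | hn
  · exact not_isResolventAt_of_mem_right ⟨0, by simp⟩ R
  intro hR
  obtain ⟨x, h1, h2⟩ := exists_dirichlet_eigenvector n
  obtain ⟨h3, h4⟩ := hR.1 (WithLp.toLp 2 ![(x : L2I), 0])
  have h5 := congrArg (fun y : L2I2 => inner ℂ (x : L2I) (y 0)) h4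
  simp only [PiLp.sub_apply, PiLp.smul_apply] at h5
  rw [opA2D_apply_zero, inner_sub_right, inner_smul_right, inner_smul_right,
    ← dirichletLaplacian_isFormalAdjoint x, h2, inner_smul_left, Complex.conj_ofReal] at h5
  have h6 : inner ℂ (x : L2I) (x : L2I) = 0 := by
    refine h5.symm.trans ?_
    push_cast
    ring
  exact dirichlet_eigenvector_ne_zero hn h1 (inner_self_eq_zero.1 h6)

theorem unboundedSpectrum_opA2D {a d : ℝ} (ha : a ≠ 0) (hd : d ≠ 0) :
    unboundedSpectrum (opA2D a d) = scaledSquares a ∪ scaledSquares d := by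
  ext z
  constructor
  · intro h
    by_contra hz
    exact h (exists_isResolventAt_of_notMem ha hd (fun h' => hz (.inl h')) fun h' => hz (.inr h'))
  · rintro (h | h) ⟨R, hR⟩
    · exact not_isResolventAt_of_mem_left h R hR
    · exact not_isResolventAt_of_mem_right h R hR

theorem notMem_scaledSquares_of_norm_le {a c : ℝ} {z : ℂ} (hc : 0 < c) (hz : z ≠ 0)
    (h : ∀ t : ℝ, 0 ≤ t → c * ‖z‖ ≤ ‖((a * t : ℝ) : ℂ) - z‖) : z ∉ scaledSquares a := by
  rintro ⟨n, hn⟩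
  have := h (Real.pi ^ 2 * (n : ℝ) ^ 2) (by positivity)
  rw [← mul_assoc, ← hn, sub_self, norm_zero] at this
  exact (mul_pos hc (norm_pos_iff.2 hz)).not_ge this

/-- The first component costs `1 / (c‖z‖)`. The right-hand side for the second has norm at most `1 +
|a|⁻¹ (1 + c⁻¹)` times that of the data, and costs the same factor again; the sum is the stated
constant. -/
theorem exists_isResolventAt_norm_le {a d c : ℝ} (ha : a ≠ 0) (hd : d ≠ 0) (hc : 0 < c) {z : ℂ}
    (hz : z ≠ 0) (hza : ∀ t : ℝ, 0 ≤ t → c * ‖z‖ ≤ ‖((a * t : ℝ) : ℂ) - z‖)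
    (hzd : ∀ t : ℝ, 0 ≤ t → c * ‖z‖ ≤ ‖((d * t : ℝ) : ℂ) - z‖) :
    ∃ R : L2I2 →L[ℂ] L2I2, IsResolventAt (opA2D a d) z R ∧
      ‖R‖ ≤ (2 + |a|⁻¹ * (1 + c⁻¹)) / c / ‖z‖ := by
  obtain ⟨R, hR⟩ := exists_isResolventAt_of_notMem ha hd
    (notMem_scaledSquares_of_norm_le hc hz hza) (notMem_scaledSquares_of_norm_le hc hz hzd)
  have hz' : 0 < ‖z‖ := norm_pos_iff.2 hz
  have ha' : (a : ℂ) ≠ 0 := by exact_mod_cast ha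
  refine ⟨R, hR, R.opNorm_le_bound (by positivity) fun y => ?_⟩
  obtain ⟨hm, h⟩ := hR.1 y
  have h0 := congrArg (fun y : L2I2 => y 0) h
  have h1 := congrArg (fun y : L2I2 => y 1) h
  simp only [PiLp.sub_apply, PiLp.smul_apply] at h0 h1
  rw [opA2D_apply_zero] at h0
  rw [opA2D_apply_one] at h1
  have b0 := mul_norm_le_of_nonneg dirichletLaplacian_nonneg hza ⟨R y 0, hm.1⟩
  have b1 := mul_norm_le_of_nonneg neumannLaplacian_nonneg hzd ⟨R y 1, hm.2⟩
  simp only at b0 b1 h0 h1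
  rw [h0] at b0
  have e : (d : ℂ) • neumannLaplacian ⟨R y 1, hm.2⟩ - z • R y 1 =
      y 1 - (a : ℂ)⁻¹ • (y 0 + z • R y 0) := by
    rw [← h1, ← h0]
    match_scalars <;> field_simp <;> ring
  rw [e] at b1
  have n0 : ‖y 0‖ ≤ ‖y‖ := PiLp.norm_apply_le y 0
  have n1 : ‖y 1‖ ≤ ‖y‖ := PiLp.norm_apply_le y 1
  have c0 : ‖z‖ * ‖R y 0‖ ≤ c⁻¹ * ‖y‖ := by
    rw [← div_eq_inv_mul, le_div_iff₀ hc]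
    linarith
  have c1 : ‖y 1 - (a : ℂ)⁻¹ • (y 0 + z • R y 0)‖ ≤ ‖y‖ + |a|⁻¹ * (‖y‖ + c⁻¹ * ‖y‖) := by
    refine (norm_sub_le _ _).trans (add_le_add n1 ?_)
    rw [norm_smul, norm_inv, Complex.norm_real, Real.norm_eq_abs]
    gcongr
    refine (norm_add_le _ _).trans (add_le_add n0 ?_)
    rwa [norm_smul]
  rw [div_div, div_mul_eq_mul_div, le_div_iff₀ (by positivity)]
  nlinarith [mul_le_mul_of_nonneg_right (L2I2_norm_le (R y)) (by positivity : 0 ≤ c * ‖z‖)]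

/-! ### The degenerate case `ad = 0` -/

theorem exists_L2I_testFunction {ψ : ℝ → ℝ} (hψ : ContDiff ℝ ∞ ψ) :
    ∃ P : L2I, IsC1Rep P (fun x => (ψ x : ℂ)) ∧
      ∀ f : L2I, inner ℂ P f = ∫ x in Ioo (0 : ℝ) 1, ψ x • f x := by
  obtain ⟨P, hP⟩ := exists_isC1Rep (u := fun x => (ψ x : ℂ))
    (Complex.ofRealCLM.contDiff.comp (hψ.of_le (by simp)))
  refine ⟨P, hP, fun f => ?_⟩
  rw [L2.inner_def]
  refine integral_congr_ae ?_
  filter_upwards [hP.2] with x hx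
  rw [RCLike.inner_apply, hx, Complex.conj_ofReal, Complex.real_smul, mul_comm]

/-- Each test identity is an equality of inner products with fixed `L²` vectors, hence stable under
limits. -/
theorem hasWeakSecondDeriv_of_tendsto {u v : ℕ → L2I} {f g : L2I}
    (h : ∀ n, HasWeakSecondDeriv (u n) (v n)) (hu : Filter.Tendsto u Filter.atTop (nhds f))
    (hv : Filter.Tendsto v Filter.atTop (nhds g)) : HasWeakSecondDeriv f g := by
  intro ψ hψ hs ht
  have hψ' : ContDiff ℝ ∞ (deriv ψ) := (contDiff_infty_iff_deriv.1 hψ).2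
  obtain ⟨P, -, hP⟩ := exists_L2I_testFunction (contDiff_infty_iff_deriv.1 hψ').2
  obtain ⟨Q, -, hQ⟩ := exists_L2I_testFunction hψ
  rw [← hP, ← hQ]
  have e n : inner ℂ P (u n) = inner ℂ Q (v n) := by
    rw [hP, hQ]
    exact h n ψ hψ hs ht
  refine tendsto_nhds_unique (tendsto_const_nhds.inner hu) ?_
  simp only [e]
  exact tendsto_const_nhds.inner hv

/-- Otherwise the closed graph theorem would bound `f ↦ f''`, while `cos nπx` is stretched by
`π²n²`. -/
theorem sobolevTwo_ne_top : sobolevTwo ≠ ⊤ := by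
  intro htop
  have hmem (f : L2I) : f ∈ sobolevTwo := htop ▸ Submodule.mem_top
  let L : L2I →ₗ[ℂ] L2I := secondDeriv ∘ₗ LinearMap.id.codRestrict sobolevTwo hmem
  have hL (f : L2I) : HasWeakSecondDeriv f (L f) := secondDeriv_spec ⟨f, hmem f⟩
  have hc : Continuous L := L.continuous_of_seq_closed_graph fun u x y hu hv =>
    (hasWeakSecondDeriv_of_tendsto (fun n => hL (u n)) hu hv).unique (hL x)
  obtain ⟨n, hn⟩ := exists_nat_gt ‖(⟨L, hc⟩ : L2I →L[ℂ] L2I)‖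
  obtain ⟨x, h1, h2⟩ := exists_neumann_eigenvector n
  have hx : 0 < ‖(x : L2I)‖ := norm_pos_iff.2 (neumann_eigenvector_ne_zero h1)
  have h3 : ‖L x‖ = Real.pi ^ 2 * (n : ℝ) ^ 2 * ‖(x : L2I)‖ := by
    rw [(hL x).unique (hasWeakSecondDeriv_negSecondDeriv neumannDomain_le x), norm_neg, h2,
      norm_smul, Complex.norm_real, Real.norm_of_nonneg (by positivity)]
  have h4 := (⟨L, hc⟩ : L2I →L[ℂ] L2I).le_opNorm x
  change ‖L x‖ ≤ _ at h4
  rw [h3] at h4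
  have h5 := le_of_mul_le_mul_right h4 hx
  have hn0 : (0 : ℝ) < n := (norm_nonneg _).trans_lt hn
  have hn1 : (1 : ℝ) ≤ n := by exact_mod_cast (Nat.cast_pos.1 hn0 : 0 < n)
  have hπ : (1 : ℝ) ≤ Real.pi ^ 2 := by nlinarith [Real.pi_gt_three]
  have h6 : (n : ℝ) ≤ Real.pi ^ 2 * (n : ℝ) ^ 2 := by
    calc (n : ℝ) ≤ 1 * (n : ℝ) ^ 2 := by nlinarith
      _ ≤ _ := by gcongr
  linarith

theorem mem_domains_of_testFunction {ψ : ℝ → ℝ} (hψ : ContDiff ℝ ∞ ψ)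
    (ht : tsupport ψ ⊆ Ioo 0 1) {P : L2I} (hP : IsC1Rep P (fun x => (ψ x : ℂ))) :
    P ∈ dirichletDomain ⊓ neumannDomain := by
  have hψ' : ContDiff ℝ ∞ (deriv ψ) := (contDiff_infty_iff_deriv.1 hψ).2
  obtain ⟨Q, hQ, -⟩ := exists_L2I_testFunction (contDiff_infty_iff_deriv.1 hψ').2
  have hd : deriv (fun x => (ψ x : ℂ)) = fun x => ((deriv ψ x : ℝ) : ℂ) := funext fun x =>
    ((hψ.differentiable (by simp) x).hasDerivAt.ofReal_comp).deriv
  have hs : P ∈ sobolevTwo := ⟨Q, hP.hasWeakSecondDeriv (by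
    rw [hd]
    exact (IsPrimitive.ofReal (hψ'.of_le (by simp))).congr (fun _ _ => rfl) hQ.2)⟩
  obtain ⟨⟨h0, h1⟩, h2, h3⟩ := testFunction_endpoints ht
  exact ⟨⟨hs, _, hP, by simp [h0], by simp [h1]⟩, ⟨hs, _, hP, by simp [hd, h2], by simp [hd, h3]⟩⟩

/-- Test functions satisfy both boundary conditions, and only `0` is orthogonal to all of them. -/
theorem dense_domains : Dense ((dirichletDomain ⊓ neumannDomain : Submodule ℂ L2I) : Set L2I) := by
  rw [Submodule.dense_iff_topologicalClosure_eq_top, Submodule.topologicalClosure_eq_top_iff,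
    Submodule.eq_bot_iff]
  intro f hf
  have key := isOpen_Ioo.ae_eq_zero_of_integral_contDiff_smul_eq_zero (U := Ioo (0 : ℝ) 1)
    (μ := volume) (f := f)
    (IntegrableOn.locallyIntegrableOn ((Lp.memLp f).integrable (by norm_num))) (by
      intro ψ hψ hs ht
      obtain ⟨P, h1, h2⟩ := exists_L2I_testFunction hψ
      rw [← setIntegral_eq_integral_of_forall_compl_eq_zero (s := Ioo (0 : ℝ) 1) (fun x hx => by
        rw [image_eq_zero_of_notMem_tsupport (fun hx' => hx (ht hx')), zero_smul]), ← h2]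
      exact hf P (mem_domains_of_testFunction hψ ht h1))
  apply Lp.ext
  filter_upwards [Lp.coeFn_zero ℂ 2 (volume.restrict (Ioo (0 : ℝ) 1)),
    (ae_restrict_iff' measurableSet_Ioo).2 key] with x h1 h2
  rw [h1, h2, Pi.zero_apply]

theorem not_isClosed_opA2D {a d : ℝ} (h : a * d = 0) : ¬ (opA2D a d).IsClosed := by
  intro hcl
  have had : (a : ℂ) * d = 0 := by exact_mod_cast h
  -- `Φ f = (-d f, f)` spans the kernel direction: where both boundary conditions hold, `A₂D` sends
  -- it to `(-ad L f, -d L f + d L f) = 0`, with `L` the common value of the two Laplacians.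
  let Φ : L2I →L[ℂ] L2I2 := ((PiLp.continuousLinearEquiv 2 ℂ (fun _ : Fin 2 => L2I)).symm :
      (Fin 2 → L2I) →L[ℂ] L2I2).comp (ContinuousLinearMap.pi
        ![-(d : ℂ) • ContinuousLinearMap.id ℂ L2I, ContinuousLinearMap.id ℂ L2I])
  have hΦ0 (f : L2I) : Φ f 0 = -(d : ℂ) • f := rfl
  have hΦ1 (f : L2I) : Φ f 1 = f := rfl
  have hS : IsClosed {f : L2I | (Φ f, (0 : L2I2)) ∈ (opA2D a d).graph} :=
    IsClosed.preimage (Φ.continuous.prodMk continuous_const) hcl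
  have hsub : ((dirichletDomain ⊓ neumannDomain : Submodule ℂ L2I) : Set L2I) ⊆
      {f : L2I | (Φ f, (0 : L2I2)) ∈ (opA2D a d).graph} := by
    rintro f ⟨h1, h2⟩
    have hm : Φ f ∈ (opA2D a d).domain := ⟨Submodule.smul_mem _ _ h1, h2⟩
    have e0 : dirichletLaplacian ⟨Φ f 0, hm.1⟩ = -(d : ℂ) • dirichletLaplacian ⟨f, h1⟩ :=
      dirichletLaplacian.map_smul _ ⟨f, h1⟩
    have e1 : neumannLaplacian ⟨Φ f 1, hm.2⟩ = dirichletLaplacian ⟨f, h1⟩ := rfl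
    refine (LinearPMap.mem_graph_iff _).2 ⟨⟨Φ f, hm⟩, rfl, L2I2_ext ?_ ?_⟩
    · rw [opA2D_apply_zero, e0, smul_smul, mul_neg, had, neg_zero, zero_smul]
      rfl
    · rw [opA2D_apply_one, e0, e1, ← add_smul, neg_add_cancel, zero_smul]
      rfl
  refine sobolevTwo_ne_top (eq_top_iff.2 fun f _ => ?_)
  obtain ⟨x, hx, -⟩ := (LinearPMap.mem_graph_iff _).1
    (hS.closure_subset_iff.2 hsub (dense_domains f))
  have h1 := x.2.2.1
  rwa [hx] at h1

theorem unboundedSpectrum_opA2D_eq_univ {a d : ℝ} (h : a * d = 0) :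
    unboundedSpectrum (opA2D a d) = univ := by
  refine eq_univ_of_forall fun z => ?_
  rintro ⟨R, hR⟩
  have had : (a : ℂ) * d = 0 := by exact_mod_cast h
  refine sobolevTwo_ne_top (eq_top_iff.2 fun f _ => ?_)
  obtain ⟨hm, hy⟩ := hR.1 (WithLp.toLp 2 ![f, 0])
  set y := R (WithLp.toLp 2 ![f, 0])
  have h0 : (opA2D a d ⟨y, hm⟩ - z • y) 0 = f := by rw [hy]; rfl
  have h1 : (opA2D a d ⟨y, hm⟩ - z • y) 1 = 0 := by rw [hy]; rfl
  rw [PiLp.sub_apply, PiLp.smul_apply, opA2D_apply_zero] at h0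
  rw [PiLp.sub_apply, PiLp.smul_apply, opA2D_apply_one] at h1
  -- Multiplying the second row by `a` removes its Neumann term and gives `a L_D φ = a z γ`, so the
  -- first row expresses `f` through `φ` and `γ`, both in `W^{2,2}`.
  have e : f = -z • y 0 + (a * z) • y 1 := by
    have h2 := congrArg (fun v : L2I => (a : ℂ) • v) h1
    simp only [smul_sub, smul_add, smul_smul, had, zero_smul, add_zero, smul_zero] at h2
    rw [← h0, sub_eq_zero.1 h2, neg_smul, sub_eq_neg_add]
  rw [e]
  exact add_mem (Submodule.smul_mem _ _ hm.1.1) (Submodule.smul_mem _ _ hm.2.1)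

/-! ### Resolvent bounds outside sectors -/

theorem exists_norm_sub_ge_of_notMem_sector {ε : ℝ} (hε : 0 < ε) :
    ∃ c : ℝ, 0 < c ∧ ∀ z : ℂ, z ∉ sector (-ε) ε →
      z ≠ 0 ∧ ∀ t : ℝ, 0 ≤ t → c * ‖z‖ ≤ ‖(t : ℂ) - z‖ := by
  have key (z : ℂ) (hz : z ∉ sector (-ε) ε) : ε < |z.arg| := by
    by_contra! h
    exact hz ⟨‖z‖, z.arg, norm_nonneg _, (abs_le.1 h).1, (abs_le.1 h).2,
      (Complex.norm_mul_exp_arg_mul_I z).symm⟩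
  have hne (z : ℂ) (hz : z ∉ sector (-ε) ε) : z ≠ 0 := by
    rintro rfl
    have := key 0 hz
    rw [Complex.arg_zero, abs_zero] at this
    exact this.not_gt hε
  rcases lt_or_ge ε Real.pi with hπ | hπ
  · refine ⟨Real.sin ε, Real.sin_pos_of_pos_of_lt_pi hε hπ, fun z hz => ⟨hne z hz, fun t ht => ?_⟩⟩
    have hcos : Real.cos z.arg ≤ Real.cos ε := by
      rw [← Real.cos_abs z.arg]
      exact Real.cos_le_cos_of_nonneg_of_le_pi hε.le (Complex.abs_arg_le_pi z) (key z hz).le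
    have hre : z.re ≤ ‖z‖ * Real.cos ε := by
      rw [← Complex.norm_mul_cos_arg z]
      exact mul_le_mul_of_nonneg_left hcos (norm_nonneg _)
    refine le_of_sq_le_sq ?_ (norm_nonneg _)
    have e : ‖(t : ℂ) - z‖ ^ 2 = t ^ 2 - 2 * t * z.re + ‖z‖ ^ 2 := by
      rw [← Complex.normSq_eq_norm_sq, ← Complex.normSq_eq_norm_sq, Complex.normSq_apply,
        Complex.normSq_apply]
      simp
      ring
    rw [e, mul_pow, Real.sin_sq]
    -- Completing the square: `t² - 2t‖z‖cos ε + ‖z‖² = (t - ‖z‖cos ε)² + ‖z‖² sin² ε`.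
    nlinarith [mul_le_mul_of_nonneg_left hre ht, sq_nonneg (t - ‖z‖ * Real.cos ε)]
  -- For `ε ≥ π` the sector is the whole plane.
  · exact ⟨1, one_pos, fun z hz => absurd (key z hz) (not_lt.2 ((Complex.abs_arg_le_pi z).trans hπ))⟩

theorem norm_ray_sub_ge {c : ℝ} {a : ℝ} {z : ℂ}
    (hp : 0 < a → ∀ t : ℝ, 0 ≤ t → c * ‖z‖ ≤ ‖(t : ℂ) - z‖)
    (hn : a < 0 → ∀ t : ℝ, 0 ≤ t → c * ‖-z‖ ≤ ‖(t : ℂ) - -z‖) (ha : a ≠ 0) (t : ℝ) (ht : 0 ≤ t) :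
    c * ‖z‖ ≤ ‖((a * t : ℝ) : ℂ) - z‖ := by
  rcases lt_or_gt_of_ne ha with h | h
  · have := hn h (-a * t) (by nlinarith)
    rw [norm_neg] at this
    refine this.trans_eq ?_
    rw [← norm_neg]
    congr 1
    push_cast
    ring
  · exact hp h _ (by positivity)

theorem exists_resolvent_bound {a d ε : ℝ} (ha : a ≠ 0) (hd : d ≠ 0) (hε : 0 < ε) :
    ∃ k : ℝ, 0 < k ∧ ∀ z : ℂ, (0 < a ∨ 0 < d → z ∉ sector (-ε) ε) →
      (a < 0 ∨ d < 0 → -z ∉ sector (-ε) ε) →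
      ∃ R : L2I2 →L[ℂ] L2I2, IsResolventAt (opA2D a d) z R ∧ ‖R‖ ≤ k / ‖z‖ := by
  obtain ⟨c, hc, H⟩ := exists_norm_sub_ge_of_notMem_sector hε
  refine ⟨(2 + |a|⁻¹ * (1 + c⁻¹)) / c, by positivity, fun z hp hn => ?_⟩
  have hz : z ≠ 0 := by
    rcases lt_or_gt_of_ne ha with h | h
    · exact neg_ne_zero.1 (H _ (hn (.inl h))).1
    · exact (H _ (hp (.inl h))).1
  exact exists_isResolventAt_norm_le ha hd hc hz
    (norm_ray_sub_ge (fun h => (H _ (hp (.inl h))).2) (fun h => (H _ (hn (.inl h))).2) ha)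
    (norm_ray_sub_ge (fun h => (H _ (hp (.inr h))).2) (fun h => (H _ (hn (.inr h))).2) hd)

theorem mem_sector_sub_pi_of_neg_mem {ε : ℝ} {z : ℂ} (hz : -z ∈ sector (-ε) ε) :
    z ∈ sector (-Real.pi - ε) (-Real.pi + ε) := by
  obtain ⟨r, θ, hr, h1, h2, h⟩ := hz
  refine ⟨r, θ - Real.pi, hr, by linarith, by linarith, ?_⟩
  rw [← neg_neg z, h]
  push_cast
  rw [sub_mul, Complex.exp_sub, Complex.exp_pi_mul_I]
  ring

/-! ### Growth of the resolvent along the real axis when `a = d` -/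

/-- `⟨x, T x⟩` is real, so the imaginary part of `⟨x, (T - z) x⟩` is `-Im z ‖x‖²`; then
Cauchy-Schwarz. -/
theorem abs_im_mul_norm_le {E : Type*} [NormedAddCommGroup E] [InnerProductSpace ℂ E]
    {T : E →ₗ.[ℂ] E} (hT : T.IsFormalAdjoint T) (z : ℂ) (x : T.domain) :
    |z.im| * ‖(x : E)‖ ≤ ‖T x - z • (x : E)‖ := by
  rcases eq_or_ne (x : E) 0 with h0 | h0
  · rw [h0, norm_zero, mul_zero]
    positivity
  have hx : 0 < ‖(x : E)‖ := norm_pos_iff.2 h0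
  have him : (inner ℂ (x : E) (T x)).im = 0 := by
    rw [← Complex.conj_eq_iff_im, inner_conj_symm, hT x x]
  have e : (inner ℂ (x : E) (T x - z • (x : E))).im = -(z.im * ‖(x : E)‖ ^ 2) := by
    rw [inner_sub_right, inner_smul_right, inner_self_eq_norm_sq_to_K, Complex.sub_im, him,
      zero_sub]
    congr 1
    change (z * (‖(x : E)‖ : ℂ) ^ 2).im = _
    rw [← Complex.ofReal_pow, Complex.im_mul_ofReal]
  have h1 := (Complex.abs_im_le_norm _).trans
    (norm_inner_le_norm (𝕜 := ℂ) (x : E) (T x - z • (x : E)))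
  rw [e, abs_neg, abs_mul, abs_of_nonneg (sq_nonneg ‖(x : E)‖)] at h1
  nlinarith

theorem IsC1Rep.norm_le_one {f : L2I} {u : ℝ → ℂ} (h : IsC1Rep f u) (hu : ∀ x, ‖u x‖ ≤ 1) :
    ‖f‖ ≤ 1 := by
  have := Lp.norm_le_of_ae_bound (f := f) zero_le_one (by
    filter_upwards [h.2] with x hx
    rw [hx]
    exact hu x)
  simpa [measureUnivNNReal] using this

theorem norm_sin_mul_le_one (c x : ℝ) : ‖Complex.sin ((c : ℂ) * x)‖ ≤ 1 := by
  rw [← Complex.ofReal_mul, ← Complex.ofReal_sin, Complex.norm_real]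
  exact Real.abs_sin_le_one _

theorem norm_cos_mul_le_one (c x : ℝ) : ‖Complex.cos ((c : ℂ) * x)‖ ≤ 1 := by
  rw [← Complex.ofReal_mul, ← Complex.ofReal_cos, Complex.norm_real]
  exact Real.abs_cos_le_one _

theorem integral_cos_mul_sin (r : ℝ) (hr : 1 ≤ r) (hc : Real.cos ((4 * r - 1) * Real.pi) = -1) :
    ∫ x in (0 : ℝ)..1, Real.cos ((2 * r - 1) * Real.pi * x) * Real.sin (2 * r * Real.pi * x) =
      (1 + 1 / (4 * r - 1)) / Real.pi := by
  have h4 : 4 * r - 1 ≠ 0 := by linarith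
  have hπ := Real.pi_ne_zero
  -- The antiderivative comes from the product-to-sum formula, with sum and difference frequencies
  -- `(4r-1)π` and `π`.
  have hd (x : ℝ) : HasDerivAt (fun x : ℝ => -(Real.cos ((4 * r - 1) * Real.pi * x) /
      ((4 * r - 1) * Real.pi) + Real.cos (Real.pi * x) / Real.pi) / 2)
      (Real.cos ((2 * r - 1) * Real.pi * x) * Real.sin (2 * r * Real.pi * x)) x := by
    have h1 (c : ℝ) : HasDerivAt (fun x : ℝ => Real.cos (c * x)) (-Real.sin (c * x) * c) x := by
      simpa using ((hasDerivAt_id x).const_mul c).cos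
    refine (((((h1 _).div_const _).add ((h1 _).div_const _)).neg).div_const 2).congr_deriv ?_
    have e1 : (4 * r - 1) * Real.pi * x = 2 * r * Real.pi * x + (2 * r - 1) * Real.pi * x := by ring
    have e2 : Real.pi * x = 2 * r * Real.pi * x - (2 * r - 1) * Real.pi * x := by ring
    rw [mul_div_cancel_right₀ _ (mul_ne_zero h4 hπ), mul_div_cancel_right₀ _ hπ, e1, e2,
      Real.sin_add, Real.sin_sub]
    ring
  rw [intervalIntegral.integral_eq_sub_of_hasDerivAt (fun x _ => hd x)
    (Continuous.intervalIntegrable (by fun_prop) _ _)]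
  simp only [mul_one, mul_zero, Real.cos_zero, hc, Real.cos_pi]
  field_simp
  ring

theorem inner_cos_sin {r : ℕ} (hr : 1 ≤ r) {f g : L2I}
    (hf : IsC1Rep f (fun t => Complex.cos ((((2 * r - 1 : ℕ) * Real.pi : ℝ) : ℂ) * t)))
    (hg : IsC1Rep g (fun t => Complex.sin ((((2 * r : ℕ) * Real.pi : ℝ) : ℂ) * t))) :
    1 / Real.pi ≤ ‖inner ℂ f g‖ := by
  have hr' : (1 : ℝ) ≤ r := by exact_mod_cast hr
  have e : inner ℂ f g = ((∫ x in (0 : ℝ)..1, Real.cos ((2 * r - 1) * Real.pi * x) *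
      Real.sin (2 * r * Real.pi * x) : ℝ) : ℂ) := by
    rw [L2.inner_def, ← intervalIntegral.integral_ofReal, ← setIntegral_Ioo_eq_intervalIntegral]
    refine integral_congr_ae ?_
    filter_upwards [hf.2, hg.2] with x h1 h2
    rw [RCLike.inner_apply, h1, h2, ← Complex.ofReal_mul, ← Complex.ofReal_mul,
      ← Complex.ofReal_cos, ← Complex.ofReal_sin, Complex.conj_ofReal, ← Complex.ofReal_mul]
    rw [Nat.cast_sub (by omega)]
    push_cast
    rw [mul_comm]
  rw [e, integral_cos_mul_sin r hr' (by
    have h := Real.cos_nat_mul_two_pi_sub_pi (2 * r)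
    rw [← h]
    push_cast
    ring_nf), Complex.norm_real, Real.norm_eq_abs]
  refine le_trans ?_ (le_abs_self _)
  have : 0 ≤ 1 / (4 * (r : ℝ) - 1) := div_nonneg zero_le_one (by linarith)
  gcongr
  linarith

/-- On input `(sin 2πrx, 0)`, the coefficient of the second output component along `cos (2r-1)πx` is
at least `4πr²/ε` divided by an eigenvalue gap of order `r`. -/
theorem resolvent_norm_ge {a ε : ℝ} (ha : a ≠ 0) (hε : 0 < ε) {r : ℕ} (hr : 1 ≤ r) {z : ℂ}
    (hre : z.re = 4 * a * Real.pi ^ 2 * (r : ℝ) ^ 2) (him : |z.im| = ε)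
    {R : L2I2 →L[ℂ] L2I2} (hR : IsResolventAt (opA2D a a) z R) :
    4 * Real.pi * r / (ε * (4 * |a| * Real.pi ^ 2 + ε)) ≤ ‖R‖ := by
  have ha' : (a : ℂ) ≠ 0 := by exact_mod_cast ha
  have hr' : (1 : ℝ) ≤ r := by exact_mod_cast hr
  have hπ := Real.pi_pos
  obtain ⟨s, hs, hs'⟩ := exists_dirichlet_eigenvector (2 * r)
  obtain ⟨q, hq, hq'⟩ := exists_neumann_eigenvector (2 * r - 1)
  obtain ⟨hm, h⟩ := hR.1 (WithLp.toLp 2 ![(s : L2I), 0])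
  set y : L2I2 := WithLp.toLp 2 ![(s : L2I), 0] with hy
  have h0 : (a : ℂ) • dirichletLaplacian ⟨R y 0, hm.1⟩ - z • R y 0 = s := by
    have := congrArg (fun v : L2I2 => v 0) h
    simp only [PiLp.sub_apply, PiLp.smul_apply] at this
    rwa [opA2D_apply_zero] at this
  have h1 : dirichletLaplacian ⟨R y 0, hm.1⟩ + (a : ℂ) • neumannLaplacian ⟨R y 1, hm.2⟩ -
      z • R y 1 = 0 := by
    have := congrArg (fun v : L2I2 => v 1) h
    simp only [PiLp.sub_apply, PiLp.smul_apply] at this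
    rwa [opA2D_apply_one] at this
  set l : ℂ := ((4 * a * Real.pi ^ 2 * (r : ℝ) ^ 2 : ℝ) : ℂ) - z with hl
  have hlre : l.re = 0 := by rw [hl, Complex.sub_re, Complex.ofReal_re, hre, sub_self]
  have hlim : l.im = -z.im := by rw [hl, Complex.sub_im, Complex.ofReal_im, zero_sub]
  have hln : ‖l‖ = ε := by
    rw [← Complex.re_add_im l, hlre, hlim, Complex.ofReal_zero, zero_add, norm_mul, Complex.norm_I,
      mul_one, Complex.norm_real, Real.norm_eq_abs, abs_neg, him]
  have hl0 : l ≠ 0 := norm_pos_iff.1 (hln ▸ hε)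
  have hs2 : (a : ℂ) • dirichletLaplacian s - z • (s : L2I) = l • (s : L2I) := by
    rw [hs', smul_smul, ← sub_smul, hl]
    congr 2
    push_cast
    ring
  -- Both sides solve `(a L_D - z) φ = s`; the lower bound by `|Im z| = ε` forces them to coincide.
  have hφ : R y 0 = l⁻¹ • (s : L2I) := by
    have b := mul_norm_le_of_nonneg (a := a) (c := ε) (z := z) dirichletLaplacian_nonneg
      (fun t _ => by
        refine le_trans ?_ (Complex.abs_im_le_norm _)
        rw [Complex.sub_im, Complex.ofReal_im, zero_sub, abs_neg, him])
      (⟨R y 0, hm.1⟩ - l⁻¹ • s)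
    rw [LinearPMap.map_sub, LinearPMap.map_smul, Submodule.coe_sub, Submodule.coe_smul] at b
    have e : (a : ℂ) • (dirichletLaplacian ⟨R y 0, hm.1⟩ - l⁻¹ • dirichletLaplacian s) -
        z • (R y 0 - l⁻¹ • (s : L2I)) = 0 := by
      have : (a : ℂ) • (dirichletLaplacian ⟨R y 0, hm.1⟩ - l⁻¹ • dirichletLaplacian s) -
          z • (R y 0 - l⁻¹ • (s : L2I)) =
          ((a : ℂ) • dirichletLaplacian ⟨R y 0, hm.1⟩ - z • R y 0) -
            l⁻¹ • ((a : ℂ) • dirichletLaplacian s - z • (s : L2I)) := by module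
      rw [this, h0, hs2, smul_smul, inv_mul_cancel₀ hl0, one_smul, sub_self]
    rw [e, norm_zero] at b
    have b' : ‖R y 0 - l⁻¹ • (s : L2I)‖ ≤ 0 := by
      by_contra! hlt
      exact (mul_pos hε hlt).not_ge b
    exact sub_eq_zero.1 (norm_le_zero_iff.1 b')
  have hDφ : dirichletLaplacian ⟨R y 0, hm.1⟩ =
      (((4 * Real.pi ^ 2 * (r : ℝ) ^ 2 : ℝ) : ℂ) * l⁻¹) • (s : L2I) := by
    have e : (⟨R y 0, hm.1⟩ : dirichletLaplacian.domain) = l⁻¹ • s := Subtype.ext hφ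
    rw [e, LinearPMap.map_smul, hs', smul_smul, mul_comm]
    congr 2
    push_cast
    ring
  set p : ℂ := inner ℂ (q : L2I) (R y 1) with hp
  -- The second row paired with the cosine, `L_N` being moved onto its eigenfunction by symmetry.
  have key : ((((a * Real.pi ^ 2 * (2 * r - 1) ^ 2 : ℝ) : ℂ)) - z) * p =
      -((((4 * Real.pi ^ 2 * (r : ℝ) ^ 2 : ℝ) : ℂ) * l⁻¹) * inner ℂ (q : L2I) (s : L2I)) := by
    have h2 := congrArg (fun v => inner ℂ (q : L2I) v) h1
    simp only [inner_sub_right, inner_add_right, inner_smul_right, hDφ, inner_zero_right] at h2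
    rw [← neumannLaplacian_isFormalAdjoint q, hq', inner_smul_left, Complex.conj_ofReal] at h2
    rw [Nat.cast_sub (by omega)] at h2
    push_cast at h2 ⊢
    linear_combination h2
  have hpn : ‖p‖ ≤ ‖R‖ := by
    calc ‖p‖ ≤ ‖(q : L2I)‖ * ‖R y 1‖ := norm_inner_le_norm _ _
      _ ≤ 1 * ‖R y‖ := mul_le_mul (hq.norm_le_one fun x => norm_cos_mul_le_one _ x)
          (PiLp.norm_apply_le _ _) (norm_nonneg _) zero_le_one
      _ ≤ ‖R‖ * ‖y‖ := by rw [one_mul]; exact R.le_opNorm y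
      _ ≤ ‖R‖ * 1 := by
          gcongr
          refine (L2I2_norm_le y).trans ?_
          have : ‖(s : L2I)‖ ≤ 1 := hs.norm_le_one fun x => norm_sin_mul_le_one _ x
          simpa [hy] using this
      _ = ‖R‖ := mul_one _
  have hnum : 4 * Real.pi * (r : ℝ) ^ 2 / ε ≤ ‖((((a * Real.pi ^ 2 * (2 * r - 1) ^ 2 : ℝ) : ℂ)) - z) * p‖ := by
    rw [key, norm_neg, norm_mul, norm_mul, norm_inv, hln, Complex.norm_real,
      Real.norm_of_nonneg (by positivity)]
    calc 4 * Real.pi * (r : ℝ) ^ 2 / ε = 4 * Real.pi ^ 2 * (r : ℝ) ^ 2 * ε⁻¹ * (1 / Real.pi) := by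
          field_simp
      _ ≤ _ := by gcongr; exact inner_cos_sin hr hq hs
  -- The quadratic terms cancel, `(2r)² - (2r-1)² = 4r - 1`, so the gap is only linear in `r`.
  have hden : ‖(((a * Real.pi ^ 2 * (2 * r - 1) ^ 2 : ℝ) : ℂ)) - z‖ ≤
      (4 * |a| * Real.pi ^ 2 + ε) * r := by
    refine (Complex.norm_le_abs_re_add_abs_im _).trans ?_
    rw [Complex.sub_re, Complex.sub_im, Complex.ofReal_re, Complex.ofReal_im, hre, zero_sub, abs_neg,
      him, show a * Real.pi ^ 2 * (2 * r - 1) ^ 2 - 4 * a * Real.pi ^ 2 * (r : ℝ) ^ 2 =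
        -(a * (Real.pi ^ 2 * (4 * r - 1))) by ring, abs_neg, abs_mul,
      abs_of_nonneg (mul_nonneg (sq_nonneg Real.pi) (by linarith : (0 : ℝ) ≤ 4 * r - 1))]
    have : 0 ≤ |a| * Real.pi ^ 2 := by positivity
    nlinarith
  rw [norm_mul] at hnum
  have hfin := hnum.trans (mul_le_mul hden hpn (norm_nonneg _) (by positivity))
  rw [div_le_iff₀ (by positivity)]
  rw [div_le_iff₀ hε] at hfin
  have hr0 : (0 : ℝ) < r := by linarith
  refine le_of_mul_le_mul_right ?_ hr0
  nlinarith

theorem resolvent_growth {a ε : ℝ} (ha : a ≠ 0) (hε : 0 < ε) : ∃ k : ℝ, 0 < k ∧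
    ∀ r : ℕ, 1 ≤ r → ∀ z : ℂ, z.re = 4 * a * Real.pi ^ 2 * (r : ℝ) ^ 2 → |z.im| = ε →
      ∃ R : L2I2 →L[ℂ] L2I2, IsResolventAt (opA2D a a) z R ∧ k * ‖z‖ ^ (1 / 4 : ℝ) ≤ ‖R‖ := by
  set C := 4 * |a| * Real.pi ^ 2 + ε with hC
  have hC0 : 0 < C := by positivity
  refine ⟨4 * Real.pi / (ε * C * (1 + C)), by positivity, fun r hr z hre him => ?_⟩
  have hz : z ∉ scaledSquares a := by
    rintro ⟨n, rfl⟩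
    rw [Complex.ofReal_im, abs_zero] at him
    exact hε.ne him
  obtain ⟨R, hR⟩ := exists_isResolventAt_of_notMem ha ha hz hz
  refine ⟨R, hR, le_trans ?_ (resolvent_norm_ge ha hε hr hre him hR)⟩
  have hr' : (1 : ℝ) ≤ r := by exact_mod_cast hr
  -- Deliberately wasteful: `‖z‖ ≤ C r²` already holds, but a fourth power is all the exponent `1/4`
  -- needs.
  have hn : ‖z‖ ≤ ((1 + C) * r) ^ 4 := by
    calc ‖z‖ ≤ |z.re| + |z.im| := Complex.norm_le_abs_re_add_abs_im _
      _ = 4 * |a| * Real.pi ^ 2 * (r : ℝ) ^ 2 + ε := by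
        rw [hre, him, abs_mul, abs_mul, abs_mul, abs_of_nonneg (sq_nonneg Real.pi),
          abs_of_nonneg (sq_nonneg (r : ℝ)), abs_of_pos (by norm_num : (0 : ℝ) < 4)]
      _ ≤ C * (r : ℝ) ^ 2 := by
        rw [hC, add_mul]
        gcongr
        exact le_mul_of_one_le_right hε.le (one_le_pow₀ hr')
      _ ≤ (1 + C) ^ 4 * (r : ℝ) ^ 4 := by
        have h1 : C ≤ (1 + C) ^ 4 :=
          (by linarith : C ≤ 1 + C).trans (le_self_pow₀ (by linarith) (by norm_num))
        have h2 : (r : ℝ) ^ 2 ≤ (r : ℝ) ^ 4 := pow_le_pow_right₀ hr' (by norm_num)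
        gcongr
      _ = _ := (mul_pow _ _ _).symm
  have hroot : ‖z‖ ^ (1 / 4 : ℝ) ≤ (1 + C) * r := by
    refine (Real.rpow_le_rpow (norm_nonneg _) hn (by norm_num)).trans_eq ?_
    rw [← Real.rpow_natCast, ← Real.rpow_mul (by positivity)]
    norm_num
  calc 4 * Real.pi / (ε * C * (1 + C)) * ‖z‖ ^ (1 / 4 : ℝ)
      ≤ 4 * Real.pi / (ε * C * (1 + C)) * ((1 + C) * r) := by gcongr
    _ = 4 * Real.pi * r / (ε * C) := by field_simp

/-! ### Similarity to self-adjoint operators -/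

section Similarity

variable {E : Type*} [NormedAddCommGroup E] [InnerProductSpace ℂ E] [CompleteSpace E]

theorem IsSimilarToSelfAdjoint.isClosed {T : E →ₗ.[ℂ] E} (h : IsSimilarToSelfAdjoint T) :
    T.IsClosed := by
  obtain ⟨S, K, hK, H⟩ := h
  have e : (T.graph : Set (E × E)) = (fun p : E × E => (S p.1, S p.2)) ⁻¹' K.graph := by
    ext ⟨x, y⟩
    exact H x y
  rw [LinearPMap.IsClosed, e]
  exact hK.isClosed.preimage
    ((S.continuous.comp continuous_fst).prodMk (S.continuous.comp continuous_snd))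

/-- Conjugation by `S` transports the bound `1 / |Im z|` for a symmetric operator at the cost of the
condition number `‖S⁻¹‖ ‖S‖`. -/
theorem IsSimilarToSelfAdjoint.exists_resolvent_bound {T : E →ₗ.[ℂ] E}
    (h : IsSimilarToSelfAdjoint T) : ∃ M : ℝ, ∀ (z : ℂ) (R : E →L[ℂ] E), |z.im| = 1 →
      IsResolventAt T z R → ‖R‖ ≤ M := by
  obtain ⟨S, K, hK, H⟩ := h
  have hKs : K.IsFormalAdjoint K := by
    have := LinearPMap.adjoint_isFormalAdjoint (IsSelfAdjoint.dense_domain hK)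
    rwa [LinearPMap.isSelfAdjoint_def.1 hK] at this
  refine ⟨‖(S.symm : E →L[ℂ] E)‖ * ‖(S : E →L[ℂ] E)‖, fun z R hz hR =>
    R.opNorm_le_bound (by positivity) fun y => ?_⟩
  obtain ⟨hm, hy⟩ := hR.1 y
  obtain ⟨v, hv1, hv2⟩ := (LinearPMap.mem_graph_iff _).1
    ((H _ _).1 ((LinearPMap.mem_graph_iff _).2 ⟨⟨R y, hm⟩, rfl, rfl⟩))
  have b := abs_im_mul_norm_le hKs z v
  change (v : E) = S (R y) at hv1
  change K v = S (T ⟨R y, hm⟩) at hv2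
  rw [hz, one_mul, hv1, hv2, ← map_smul, ← map_sub, hy] at b
  calc ‖R y‖ = ‖(S.symm : E →L[ℂ] E) (S (R y))‖ := by simp
    _ ≤ ‖(S.symm : E →L[ℂ] E)‖ * ‖S (R y)‖ := ContinuousLinearMap.le_opNorm _ _
    _ ≤ ‖(S.symm : E →L[ℂ] E)‖ * (‖(S : E →L[ℂ] E)‖ * ‖y‖) := by
        gcongr
        exact b.trans ((S : E →L[ℂ] E).le_opNorm y)
    _ = _ := (mul_assoc _ _ _).symm

end Similarity

theorem not_isSimilarToSelfAdjoint_opA2D (a : ℝ) : ¬ IsSimilarToSelfAdjoint (opA2D a a) := by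
  intro h
  rcases eq_or_ne a 0 with rfl | ha
  · exact not_isClosed_opA2D (mul_zero 0) h.isClosed
  obtain ⟨M, hM⟩ := h.exists_resolvent_bound
  obtain ⟨r, hr⟩ := exists_nat_gt (M * (1 * (4 * |a| * Real.pi ^ 2 + 1)) / (4 * Real.pi))
  -- The shift guarantees `r' ≥ 1`, as the lower bound requires.
  set r' := r + 1 with hr'
  set z : ℂ := ⟨4 * a * Real.pi ^ 2 * (r' : ℝ) ^ 2, 1⟩ with hz
  have him : |z.im| = 1 := abs_one
  obtain ⟨k, -, hk⟩ := resolvent_growth ha one_pos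
  obtain ⟨R, hR, -⟩ := hk r' (by omega) z rfl him
  have h1 := (resolvent_norm_ge ha one_pos (by omega : 1 ≤ r') (by rfl : z.re = _) him hR).trans
    (hM z R him hR)
  rw [div_le_iff₀ (by positivity)] at h1
  rw [div_lt_iff₀ (by positivity)] at hr
  have h2 : (r : ℝ) < r' := by rw [hr']; push_cast; linarith
  nlinarith [Real.pi_pos]

/-! ### Assembly of statements (a) to (f) -/

theorem mainTheorem1 (a d : ℝ) :
    -- (a)
    (a * d = 0 → ¬ (opA2D a d).IsClosed ∧ unboundedSpectrum (opA2D a d) = Set.univ) ∧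
    -- (b)
    (a * d ≠ 0 →
      unboundedSpectrum (opA2D a d) =
        {z : ℂ | ∃ n : ℕ, z = ((a * Real.pi ^ 2 * (n : ℝ) ^ 2 : ℝ) : ℂ) ∨
          z = ((d * Real.pi ^ 2 * (n : ℝ) ^ 2 : ℝ) : ℂ)} ∧
      ∀ z ∈ unboundedSpectrum (opA2D a d), z.im = 0) ∧
    -- (c)
    (0 < a * d → ∀ ε : ℝ, 0 < ε → ∃ k : ℝ, 0 < k ∧
      ∀ z : ℂ, (0 < a ∧ z ∉ sector (-ε) ε) ∨ (a < 0 ∧ z ∉ -sector (-ε) ε) →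
        ∃ R : L2I2 →L[ℂ] L2I2, IsResolventAt (opA2D a d) z R ∧ ‖R‖ ≤ k / ‖z‖) ∧
    -- (d)
    (a * d < 0 → ∀ ε : ℝ, 0 < ε → ∃ k : ℝ, 0 < k ∧
      ∀ z : ℂ, z ∉ sector (-ε) ε ∪ sector (-Real.pi - ε) (-Real.pi + ε) →
        ∃ R : L2I2 →L[ℂ] L2I2, IsResolventAt (opA2D a d) z R ∧ ‖R‖ ≤ k / ‖z‖) ∧
    -- (e)
    (a = d → a ≠ 0 → ∀ ε : ℝ, 0 < ε → ∃ k : ℝ, 0 < k ∧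
      ∀ r : ℕ, 1 ≤ r → ∀ z : ℂ,
        z = ((4 * a * Real.pi ^ 2 * (r : ℝ) ^ 2 : ℝ) : ℂ) + (ε : ℂ) * Complex.I ∨
          z = ((4 * a * Real.pi ^ 2 * (r : ℝ) ^ 2 : ℝ) : ℂ) - (ε : ℂ) * Complex.I →
        ∃ R : L2I2 →L[ℂ] L2I2, IsResolventAt (opA2D a d) z R ∧
          k * ‖z‖ ^ (1 / 4 : ℝ) ≤ ‖R‖) ∧
    (a = d → ¬ IsSimilarToSelfAdjoint (opA2D a d)) := by
  refine ⟨fun h => ⟨not_isClosed_opA2D h, unboundedSpectrum_opA2D_eq_univ h⟩, fun h => ?_,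
    fun h ε hε => ?_, fun h ε hε => ?_, ?_, ?_⟩
  · have hs := unboundedSpectrum_opA2D (left_ne_zero_of_mul h) (right_ne_zero_of_mul h)
    refine ⟨?_, fun z hz => ?_⟩
    · rw [hs]
      ext z
      exact exists_or.symm
    · rw [hs] at hz
      rcases hz with ⟨n, rfl⟩ | ⟨n, rfl⟩ <;> exact Complex.ofReal_im _
  · obtain ⟨k, hk, H⟩ := exists_resolvent_bound (left_ne_zero_of_mul h.ne')
      (right_ne_zero_of_mul h.ne') hε
    refine ⟨k, hk, fun z hz => H z ?_ ?_⟩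
    · intro h'
      rcases hz with hz | hz
      · exact hz.2
      · rcases h' with h' | h' <;> nlinarith [hz.1]
    · intro h'
      rcases hz with hz | hz
      · rcases h' with h' | h' <;> nlinarith [hz.1]
      · exact hz.2
  · obtain ⟨k, hk, H⟩ := exists_resolvent_bound (left_ne_zero_of_mul h.ne)
      (right_ne_zero_of_mul h.ne) hε
    exact ⟨k, hk, fun z hz => H z (fun _ h' => hz (.inl h'))
      fun _ h' => hz (.inr (mem_sector_sub_pi_of_neg_mem h'))⟩
  · rintro rfl ha ε hε
    obtain ⟨k, hk, H⟩ := resolvent_growth ha hε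
    refine ⟨k, hk, fun r hr z hz => H r hr z ?_ ?_⟩
    · rcases hz with rfl | rfl <;>
        simp only [Complex.add_re, Complex.sub_re, Complex.ofReal_re, Complex.re_ofReal_mul,
          Complex.I_re, mul_zero, add_zero, sub_zero]
    · rcases hz with rfl | rfl <;>
        simp only [Complex.add_im, Complex.sub_im, Complex.ofReal_im, Complex.im_ofReal_mul,
          Complex.I_im, mul_one, zero_add, zero_sub, abs_neg, abs_of_pos hε]
  · rintro rfl
    exact not_isSimilarToSelfAdjoint_opA2D a
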